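/- Let $(\Omega,\mathcal F,\mathbb P_0)$ be a probability space, $X\in L^1(\mathbb P_0)$ real-valued and $r>0$. Let $\Phi_0$ be the set of convex functions $\phi:\mathbb R\to[0,\infty]$ with $\phi(1)=0$ whose effective domain $\{t:\phi(t)<\infty\}$ is contained in $[0,\infty)$ and contains a neighbourhood of $1$, and let $\phi_1,\phi_2\in\Phi_0$ be lower semicontinuous. For probability measures put $I_\phi(\mathbb Q,\mathbb P)=\int\phi\big(\tfrac{d\mathbb Q}{d\mathbb P}\big)\,d\mathbb P$ if $\mathbb Q\ll\mathbb P$ and $I_\phi(\mathbb Q,\mathbb P)=+\infty$ otherwise. Write $\phi^\lambda(t)=\lambda\phi(t/\lambda)$ for $\lambda>0$, and $\phi^*(s)=\sup_{t\in\mathbb R}\{st-\phi(t)\}$ with $\phi^*(+\infty)=+\infty$; for $\eta=0$ read $0\,\phi^*(s/0)$ as $0$ if $s\le 0$ and as $+\infty$ if $s>0$. Define the robust shortfall risk measure $$\rho(X)=\sup_{\lambda>0}\ \sup_{\mathbb Q:\,I_{\phi_2}(\mathbb Q,\mathbb P_0)\le r}\ \sup_{\bar{\mathbb Q}\ll\mathbb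 Q}\ \Big(\mathbb E_{\bar{\mathbb Q}}[-X]-I_{\phi_1^\lambda}(\bar{\mathbb Q},\mathbb Q)\Big),$$ where $\mathbb Q,\bar{\mathbb Q}$ range over probability measures on $(\Omega,\mathcal F)$ and $\infty-\infty$ is read as $-\infty$. For $x,\theta_1,\theta_2\in\mathbb R$ and $\eta\ge 0$ put $$\beta^*(x,\theta_1,\theta_2,\eta)=\eta\,\phi_2^*\Big(\frac{\phi_1^*(-\theta_2-x)+\theta_1}{\eta}\Big).$$ (1) If the law of $X$ under $\mathbb P_0$ has a real-valued density $f_0\ge 0$ with respect to a $\sigma$-finite measure $dx$ on $\mathbb R$, then $\rho(X)$ is finite if and only if there exist $\theta_1,\theta_2\in\mathbb R$ and $\eta\ge 0$ such that $$\int_{\mathbb R}\eta\,\phi_2^*\Big(\frac{\phi_1^*(-\theta_2-x)+\theta_1}{\eta}\Big)f_0(x)\,dx\le\theta_1-\eta r .$$ (2) Moreover, with $\inf\emptyset=+\infty$, $$\rho(X)=\inf_{\theta_1,\theta_2\in\mathbb R,\ \eta\ge 0}\big\{\theta_2\ :\ \mathbb E_{\mathbb P_0}[\beta^*(X,\theta_1,\theta_2,\eta)]\le\theta_1-\eta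 r\big\}.$$ -/

import Mathlib

open MeasureTheory Topology
open scoped ENNReal NNReal

noncomputable section

/-- The class of divergence functions: convex functions `φ : ℝ → [0, ∞]` with `φ 1 = 0` whose
effective domain `{t | φ t < ∞}` is contained in `[0, ∞)` and contains a neighbourhood of `1`.
(Convexity of a `[0, ∞]`-valued function is expressed with weights in `ℝ≥0`.) -/
structure IsDivergenceFunction (φ : ℝ → ℝ≥0∞) : Prop where
  convexOn : ConvexOn ℝ≥0 Set.univ φ
  map_one : φ 1 = 0
  eq_top_of_neg : ∀ t : ℝ, t < 0 → φ t = ⊤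
  finite_near_one : ∀ᶠ t in 𝓝 (1 : ℝ), φ t < ⊤

open scoped Classical in
/-- The `φ`-divergence `I_φ(Q, P)`: it is `∫ φ(dQ/dP) dP` if `Q ≪ P`, and `∞` otherwise. -/
def phiDivergence {Ω : Type*} [MeasurableSpace Ω] (φ : ℝ → ℝ≥0∞) (Q P : Measure Ω) : ℝ≥0∞ :=
  if Q ≪ P then ∫⁻ ω, φ (Q.rnDeriv P ω).toReal ∂P else ⊤

/-- The rescaled function `φ^c(t) = c φ(t / c)` for `c > 0`. -/
def scaledDivergence (φ : ℝ → ℝ≥0∞) (c : ℝ) : ℝ → ℝ≥0∞ :=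
  fun t => ENNReal.ofReal c * φ (t / c)

/-- The integral of an extended-real function: integral of the positive part minus integral of
the negative part, where `∞ - ∞ = -∞` (the convention of `EReal`). -/
def extIntegral {α : Type*} [MeasurableSpace α] (μ : Measure α) (f : α → EReal) : EReal :=
  ((∫⁻ a, (f a).toENNReal ∂μ : ℝ≥0∞) : EReal) - ((∫⁻ a, (-f a).toENNReal ∂μ : ℝ≥0∞) : EReal)

/-- The convex conjugate `φ*(s) = sup_t (s t - φ t)`. The argument may be `+∞`, where the same
formula gives `φ*(+∞) = +∞` as soon as `φ` is finite at some `t > 0`. -/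
def conj (φ : ℝ → ℝ≥0∞) (s : EReal) : EReal :=
  ⨆ t : ℝ, s * (t : EReal) - (φ t : EReal)

/-- The expression `η φ*(s / η)` for `η ≥ 0`, with `0 φ*(s / 0) = 0` if `s ≤ 0` and
`0 φ*(s / 0) = +∞` if `s > 0`. -/
def conjPersp (φ : ℝ → ℝ≥0∞) (η : ℝ) (s : EReal) : EReal :=
  if η = 0 then (if s ≤ 0 then 0 else ⊤) else (η : EReal) * conj φ (s / (η : EReal))

/-- The dual integrand `β*(x, θ₁, θ₂, η) = η φ₂*((φ₁*(-θ₂ - x) + θ₁) / η)`. -/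
def dualIntegrand (φ₁ φ₂ : ℝ → ℝ≥0∞) (x θ₁ θ₂ η : ℝ) : EReal :=
  conjPersp φ₂ η (conj φ₁ ((-θ₂ - x : ℝ) : EReal) + (θ₁ : EReal))

/-- The robust shortfall risk measure: the supremum over all `c > 0`, all probability measures
`Q` with `I_{φ₂}(Q, P₀) ≤ r` and all probability measures `Q' ≪ Q` of
`E_{Q'}[-X] - I_{φ₁^c}(Q', Q)`. By the convention `∞ - ∞ = -∞`, a `Q'` for which the
objective is undefined does not contribute. -/
def robustShortfall {Ω : Type*} [MeasurableSpace Ω] (φ₁ φ₂ : ℝ → ℝ≥0∞) (P₀ : Measure Ω)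
    (r : ℝ) (X : Ω → ℝ) : EReal :=
  ⨆ (c : ℝ) (_ : 0 < c)
    (Q : Measure Ω) (_ : IsProbabilityMeasure Q)
    (_ : phiDivergence φ₂ Q P₀ ≤ ENNReal.ofReal r)
    (Q' : Measure Ω) (_ : IsProbabilityMeasure Q') (_ : Q' ≪ Q),
      extIntegral Q' (fun ω => ((-X ω : ℝ) : EReal)) -
        (phiDivergence (scaledDivergence φ₁ c) Q' Q : EReal)

end

/-!
Lagrangian duality for the robust shortfall risk measure, written below with `Y = -θ₂ - X` and
`h = φ₁*(Y)`.

*Upper bound* (`robustShortfall_le`). If `(θ₁, θ₂, η)` is dual feasible, `Q = q P₀` and `Q' = Z Q`,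
two Fenchel inequalities give
`q Z Y ≤ c q φ₁(Z / c) + c (η φ₂(q) - θ₁ q + β*)` almost everywhere. Integrating against `P₀`
bounds the objective by `θ₂`.

*Lower bound.* Let `θ₂` be a real number above the risk measure. Because the supremum runs over all
`c > 0`, the inner problem is positively homogeneous: for every admissible density `q` and every
`z ≥ 0` (bounded, with values in the domain of `φ₁`) one gets `E[q (z Y - φ₁(z))] ≤ 0`, without any
normalization of `z` (`integral_mul_le_zero_of_robustShortfall_le`). A measurable choice of
near-maximizers `z` turns this into `E[q h] ≤ 0` for all densities `q` with `E[φ₂(q)] ≤ r`. This is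
a concave problem with two scalar constraints, so separation in `ℝ³` gives multipliers `θ₁` and
`η ≥ 0` (`exists_multipliers`); a measurable choice of near-maximizers `q` and monotone convergence
give `E[sup_t (t (h + θ₁) - η φ₂(t))] ≤ θ₁ - η r` (`exists_dual_bound`). All suprema can be taken
over countable sets since a divergence function decreases along segments towards `1`
(`IsDivergenceFunction.exists_seq`).

For `η > 0` this is dual feasibility of `(θ₁, θ₂, η)`. For `η = 0` the convention on
`0 φ₂*(s / 0)` may exceed the support function of the domain of `φ₂`, and feasibility is recovered
after raising `θ₂` by an arbitrarily small amount (`exists_feasible`), which does not affect the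
infimum.

The finiteness criterion follows: the risk measure is never `-∞`, and it is `+∞` exactly when no
triple is feasible; the integral against the density is the same one after a change of variables.
-/

open IsDivergenceFunction

/-! ### Integrals of extended-real functions -/

theorem extIntegral_mono_ae {α : Type*} [MeasurableSpace α] {μ : Measure α} {f g : α → EReal}
    (h : ∀ᵐ a ∂μ, f a ≤ g a) : extIntegral μ f ≤ extIntegral μ g := by
  unfold extIntegral
  refine EReal.sub_le_sub ?_ ?_
  · exact_mod_cast lintegral_mono_ae (h.mono fun a ha => EReal.toENNReal_le_toENNReal ha)
  · exact_mod_cast lintegral_mono_ae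
      (h.mono fun a ha => EReal.toENNReal_le_toENNReal (EReal.neg_le_neg_iff.2 ha))

theorem extIntegral_congr_ae {α : Type*} [MeasurableSpace α] {μ : Measure α} {f g : α → EReal}
    (h : ∀ᵐ a ∂μ, f a = g a) : extIntegral μ f = extIntegral μ g :=
  le_antisymm (extIntegral_mono_ae (h.mono fun _ ha => ha.le))
    (extIntegral_mono_ae (h.mono fun _ ha => ha.ge))

theorem extIntegral_coe {α : Type*} [MeasurableSpace α] {μ : Measure α} {F : α → ℝ}
    (hF : Integrable F μ) :
    extIntegral μ (fun a => (F a : EReal)) = ((∫ a, F a ∂μ : ℝ) : EReal) := by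
  have h1 : ∫⁻ a, ENNReal.ofReal (F a) ∂μ ≠ ⊤ := hF.lintegral_lt_top.ne
  have h2 : ∫⁻ a, ENNReal.ofReal (-F a) ∂μ ≠ ⊤ := hF.neg.lintegral_lt_top.ne
  unfold extIntegral
  rw [integral_eq_lintegral_pos_part_sub_lintegral_neg_part hF]
  simp only [← EReal.coe_neg, EReal.toENNReal_of_ne_top (EReal.coe_ne_top _), EReal.toReal_coe]
  rw [EReal.coe_sub, EReal.coe_ennreal_toReal h1, EReal.coe_ennreal_toReal h2]

theorem extIntegral_eq_zero_of_ae {α : Type*} [MeasurableSpace α] {μ : Measure α} {f : α → EReal}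
    (h : ∀ᵐ a ∂μ, f a = 0) : extIntegral μ f = 0 := by
  rw [extIntegral_congr_ae (g := fun _ => 0) h]
  simp [extIntegral]

/-- An extended-real function with an integrable minorant and an integral below a real number is
almost everywhere equal to an integrable real function. -/
theorem exists_integrable_of_extIntegral_le {α : Type*} [MeasurableSpace α] {μ : Measure α}
    {f : α → EReal} (hf : AEMeasurable f μ) {g : α → ℝ} (hg : Integrable g μ)
    (hgf : ∀ᵐ a ∂μ, (g a : EReal) ≤ f a) {C : ℝ} (hC : extIntegral μ f ≤ (C : EReal)) :
    ∃ F : α → ℝ, Integrable F μ ∧ (∀ᵐ a ∂μ, f a = (F a : EReal)) ∧ ∫ a, F a ∂μ ≤ C := by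
  have hneg : ∫⁻ a, (-f a).toENNReal ∂μ ≠ ⊤ := by
    refine ne_top_of_le_ne_top hg.neg.lintegral_lt_top.ne (lintegral_mono_ae ?_)
    filter_upwards [hgf] with a ha
    have := EReal.toENNReal_le_toENNReal (EReal.neg_le_neg_iff.2 ha)
    rwa [← EReal.coe_neg, EReal.toENNReal_of_ne_top (EReal.coe_ne_top _),
      EReal.toReal_coe] at this
  have hpos : ∫⁻ a, (f a).toENNReal ∂μ ≠ ⊤ := by
    intro h
    unfold extIntegral at hC
    rw [h, EReal.coe_ennreal_top, EReal.top_sub (by simpa using hneg)] at hC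
    exact absurd hC (by simp)
  have hfin : ∀ᵐ a ∂μ, f a = ((f a).toReal : EReal) := by
    filter_upwards [ae_lt_top' hf.ereal_toENNReal hpos, hgf] with a ha hga
    refine (EReal.coe_toReal ?_ ?_).symm
    · intro h; simp [h] at ha
    · intro h; simp [h] at hga
  have hint : Integrable (fun a => (f a).toReal) μ := by
    have hp : Integrable (fun a => ((f a).toENNReal).toReal) μ :=
      integrable_toReal_of_lintegral_ne_top hf.ereal_toENNReal hpos
    refine (hp.add hg.abs).mono' hf.ereal_toReal.aestronglyMeasurable ?_
    filter_upwards [hfin, hgf] with a ha hga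
    rw [ha] at hga
    have hga' : g a ≤ (f a).toReal := by exact_mod_cast hga
    have : ((f a).toENNReal).toReal = max (f a).toReal 0 := by
      rw [ha, EReal.toENNReal_of_ne_top (EReal.coe_ne_top _), EReal.toReal_coe,
        ENNReal.toReal_ofReal']
    simp only [Pi.add_apply, this, Real.norm_eq_abs]
    rcases le_total 0 (f a).toReal with h | h
    · rw [abs_of_nonneg h, max_eq_left h]; linarith [abs_nonneg (g a)]
    · rw [abs_of_nonpos h, max_eq_right h]; linarith [neg_abs_le (g a)]
  refine ⟨_, hint, hfin, ?_⟩
  rw [extIntegral_congr_ae hfin, extIntegral_coe hint] at hC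
  exact_mod_cast hC

/-- Monotone convergence in the form of a dominating function: an increasing sequence of
integrable functions with bounded integrals has an integrable upper bound whose integral obeys
the same bound. -/
theorem exists_integrable_ge_of_monotone {α : Type*} [MeasurableSpace α] {μ : Measure α}
    {f : ℕ → α → ℝ} (hf : ∀ n, Integrable (f n) μ) (hmono : ∀ a, Monotone fun n => f n a)
    {C : ℝ} (hC : ∀ n, ∫ a, f n a ∂μ ≤ C) :
    ∃ F : α → ℝ, Integrable F μ ∧ ∫ a, F a ∂μ ≤ C ∧ ∀ᵐ a ∂μ, ∀ n, f n a ≤ F a := by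
  set d : ℕ → α → ℝ≥0∞ := fun n a => ENNReal.ofReal (f n a - f 0 a) with hd
  have hdm : ∀ n, AEMeasurable (d n) μ := fun n =>
    ((hf n).sub (hf 0)).aestronglyMeasurable.aemeasurable.ennreal_ofReal
  have hle : ∫⁻ a, ⨆ n, d n a ∂μ ≤ ENNReal.ofReal (C - ∫ a, f 0 a ∂μ) := by
    rw [lintegral_iSup' hdm (Filter.Eventually.of_forall fun a m n hmn =>
      ENNReal.ofReal_le_ofReal (sub_le_sub_right (hmono a hmn) _))]
    refine iSup_le fun n => ?_
    rw [show ∫⁻ a, d n a ∂μ = ENNReal.ofReal (∫ a, (f n - f 0) a ∂μ) from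
      (ofReal_integral_eq_lintegral_ofReal ((hf n).sub (hf 0))
        (Filter.Eventually.of_forall fun a => sub_nonneg.2 (hmono a (Nat.zero_le n)))).symm]
    refine ENNReal.ofReal_le_ofReal ?_
    simp only [Pi.sub_apply]
    rw [integral_sub (hf n) (hf 0)]
    linarith [hC n]
  have hGm : AEMeasurable (fun a => ⨆ n, d n a) μ := AEMeasurable.iSup hdm
  have hne : ∫⁻ a, ⨆ n, d n a ∂μ ≠ ⊤ := ne_top_of_le_ne_top ENNReal.ofReal_ne_top hle
  have hG := integrable_toReal_of_lintegral_ne_top hGm hne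
  refine ⟨fun a => f 0 a + (⨆ n, d n a).toReal, (hf 0).add hG, ?_, ?_⟩
  · rw [integral_add (hf 0) hG, integral_toReal hGm (ae_lt_top' hGm hne)]
    have := ENNReal.toReal_mono ENNReal.ofReal_ne_top hle
    rw [ENNReal.toReal_ofReal (by linarith [hC 0])] at this
    linarith
  · filter_upwards [ae_lt_top' hGm hne] with a ha n
    have h1 : d n a ≤ ⨆ n, d n a := le_iSup (fun n => d n a) n
    have := (ENNReal.ofReal_le_iff_le_toReal ha.ne).1 h1
    linarith

/-- A measurable choice of an index at which the maximum of `g 0, …, g n` is attained. -/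
theorem exists_measurable_argmax {α : Type*} [MeasurableSpace α] {g : ℕ → α → ℝ}
    (hg : ∀ i, Measurable (g i)) (n : ℕ) :
    ∃ N : α → ℕ, Measurable N ∧ (∀ a, N a ≤ n) ∧ ∀ a, partialSups (fun i => g i a) n = g (N a) a := by
  induction n with
  | zero => exact ⟨fun _ => 0, measurable_const, fun _ => le_rfl, fun a => by simp⟩
  | succ n ih =>
    obtain ⟨N, hN, hNn, hmax⟩ := ih
    have hgN : Measurable fun a => g (N a) a := by
      have h : Measurable fun p : ℕ × α => g p.1 p.2 := measurable_from_prod_countable_right hg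
      exact h.comp (hN.prodMk measurable_id)
    classical
    refine ⟨fun a => if g (N a) a < g (n + 1) a then n + 1 else N a,
      Measurable.ite (measurableSet_lt hgN (hg _)) measurable_const hN, fun a => ?_, fun a => ?_⟩
    · dsimp only; split_ifs
      · exact le_rfl
      · exact (hNn a).trans (Nat.le_succ n)
    · rw [← Order.succ_eq_add_one, partialSups_succ, hmax]
      simp only [Order.succ_eq_add_one]
      split_ifs with h
      · exact max_eq_right h.le
      · exact max_eq_left (not_lt.1 h)

theorem integrable_partialSups {α : Type*} [MeasurableSpace α] {μ : Measure α} {g : ℕ → α → ℝ}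
    (hg : ∀ i, Integrable (g i) μ) (n : ℕ) :
    Integrable (fun a => partialSups (fun i => g i a) n) μ := by
  induction n with
  | zero => simpa using hg 0
  | succ n ih =>
    simp only [← Order.succ_eq_add_one, partialSups_succ]
    exact ih.sup (hg _)

/-! ### Divergence functions and their conjugates -/

namespace IsDivergenceFunction

variable {φ : ℝ → ℝ≥0∞}

theorem nonneg_of_lt_top (hφ : IsDivergenceFunction φ) {t : ℝ} (ht : φ t < ⊤) : 0 ≤ t := by
  by_contra h
  exact ht.ne (hφ.eq_top_of_neg t (not_le.1 h))

theorem one_lt_top (hφ : IsDivergenceFunction φ) : φ 1 < ⊤ := by simp [hφ.map_one]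

theorem le_add (hφ : IsDivergenceFunction φ) {a b : ℝ} (ha : 0 ≤ a) (hb : 0 ≤ b)
    (hab : a + b = 1) (s t : ℝ) :
    φ (a * s + b * t) ≤ ENNReal.ofReal a * φ s + ENNReal.ofReal b * φ t := by
  lift a to ℝ≥0 using ha
  lift b to ℝ≥0 using hb
  rw [ENNReal.ofReal_coe_nnreal, ENNReal.ofReal_coe_nnreal]
  exact hφ.convexOn.2 (Set.mem_univ s) (Set.mem_univ t) (zero_le : 0 ≤ a) (zero_le : 0 ≤ b)
    (by exact_mod_cast hab)

theorem exists_Icc_lt_top (hφ : IsDivergenceFunction φ) :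
    ∃ δ : ℝ, 0 < δ ∧ δ < 1 ∧ ∀ t ∈ Set.Icc (1 - δ) (1 + δ), φ t < ⊤ := by
  obtain ⟨ε, hε, h⟩ := Metric.eventually_nhds_iff.1 hφ.finite_near_one
  refine ⟨min (ε / 2) (1 / 2), by positivity, (min_le_right _ _).trans_lt (by norm_num), ?_⟩
  intro t ht
  refine h ?_
  have := min_le_left (ε / 2) (1 / 2)
  rw [Real.dist_eq, abs_lt]
  constructor <;> linarith [ht.1, ht.2]

/-- Between `1` and a point of the domain, `φ` does not exceed its value at that point. -/
theorem lineMap_one_le (hφ : IsDivergenceFunction φ) {a t : ℝ} (ha : 0 ≤ a) (ha1 : a ≤ 1) :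
    φ ((1 - a) * t + a * 1) ≤ φ t := by
  refine (hφ.le_add (sub_nonneg.2 ha1) ha (by ring) t 1).trans ?_
  rw [hφ.map_one, mul_zero, add_zero]
  exact mul_le_of_le_one_left' (ENNReal.ofReal_le_one.2 (by linarith))

/-- A countable subset of the domain suffices to compute the conjugate and its perspective.
The rational points of the domain will do, because `φ` decreases along segments towards `1`. -/
theorem exists_seq (hφ : IsDivergenceFunction φ) :
    ∃ u : ℕ → ℝ, u 0 = 1 ∧ (∀ n, φ (u n) < ⊤) ∧ ∀ s η y : ℝ, 0 ≤ η →
      (∀ n, u n * s - η * (φ (u n)).toReal ≤ y) →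
        ∀ t, φ t < ⊤ → t * s - η * (φ t).toReal ≤ y := by
  let S : Set ℚ := {x | φ (x : ℝ) < ⊤}
  have h1S : (1 : ℚ) ∈ S := by simp [S, hφ.map_one]
  obtain ⟨e, he⟩ := (Set.to_countable S).exists_eq_range ⟨1, h1S⟩
  have heS : ∀ n, e n ∈ S := fun n => he ▸ Set.mem_range_self n
  refine ⟨fun n => Nat.casesOn n 1 (fun k => (e k : ℝ)), rfl, ?_, ?_⟩
  · rintro (_ | k)
    · exact hφ.one_lt_top
    · exact heS k
  intro s η y hη hy t ht
  have hrat : ∀ x : ℚ, φ (x : ℝ) < ⊤ → (x : ℝ) * s - η * (φ x).toReal ≤ y := by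
    intro x hx
    have : x ∈ Set.range e := he ▸ (show x ∈ S from hx)
    obtain ⟨k, rfl⟩ := this
    exact hy (k + 1)
  rcases eq_or_ne t 1 with rfl | hne
  · simpa using hy 0
  refine le_of_forall_pos_le_add fun ε hε => ?_
  -- a rational point `x` between `t` and `1`, close to `t`
  obtain ⟨x, hx, a, ha0, ha1, hax⟩ : ∃ x : ℚ, |t - x| * |s| ≤ ε ∧
      ∃ a : ℝ, 0 ≤ a ∧ a ≤ 1 ∧ (x : ℝ) = (1 - a) * t + a * 1 := by
    set κ := ε / (|s| + 1) with hκ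
    have hκ0 : 0 < κ := by positivity
    have hκs : κ * |s| ≤ ε := by
      rw [hκ, div_mul_eq_mul_div, div_le_iff₀ (by positivity)]
      nlinarith [abs_nonneg s]
    rcases lt_or_gt_of_ne hne with h | h
    · obtain ⟨x, hx1, hx2⟩ := exists_rat_btwn (show t < min 1 (t + κ) from
        lt_min h (by linarith))
      have h1 : (x : ℝ) < 1 := hx2.trans_le (min_le_left _ _)
      have h2 : (x : ℝ) < t + κ := hx2.trans_le (min_le_right _ _)
      refine ⟨x, le_trans (mul_le_mul_of_nonneg_right ?_ (abs_nonneg s)) hκs,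
        (x - t) / (1 - t), div_nonneg (by linarith) (by linarith), ?_, ?_⟩
      · rw [abs_le]; constructor <;> linarith
      · rw [div_le_one (by linarith)]; linarith
      · have : (1 - t) ≠ 0 := by linarith
        field_simp
        ring
    · obtain ⟨x, hx1, hx2⟩ := exists_rat_btwn (show max 1 (t - κ) < t from
        max_lt h (by linarith))
      have h1 : 1 < (x : ℝ) := (le_max_left _ _).trans_lt hx1
      have h2 : t - κ < (x : ℝ) := (le_max_right _ _).trans_lt hx1
      refine ⟨x, le_trans (mul_le_mul_of_nonneg_right ?_ (abs_nonneg s)) hκs,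
        (t - x) / (t - 1), div_nonneg (by linarith) (by linarith), ?_, ?_⟩
      · rw [abs_le]; constructor <;> linarith
      · rw [div_le_one (by linarith)]; linarith
      · have : (t - 1) ≠ 0 := by linarith
        field_simp
        ring
  have hφx : φ (x : ℝ) ≤ φ t := hax ▸ hφ.lineMap_one_le ha0 ha1
  have h1 := hrat x (hφx.trans_lt ht)
  have h2 : η * (φ (x : ℝ)).toReal ≤ η * (φ t).toReal :=
    mul_le_mul_of_nonneg_left (ENNReal.toReal_mono ht.ne hφx) hη
  have h3 : (t - x) * s ≤ |t - x| * |s| := by rw [← abs_mul]; exact le_abs_self _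
  linarith

theorem conj_le_iff {s y : ℝ} : conj φ s ≤ (y : EReal) ↔
    ∀ t, φ t < ⊤ → t * s - (φ t).toReal ≤ y := by
  unfold conj
  rw [iSup_le_iff]
  refine forall_congr' fun t => ?_
  rcases eq_or_ne (φ t) ⊤ with h | h
  · simp [h, ← EReal.coe_mul]
  · rw [← EReal.coe_ennreal_toReal h, ← EReal.coe_mul, ← EReal.coe_sub, EReal.coe_le_coe_iff,
      mul_comm t s]
    simp [h.lt_top]

theorem conj_mono (hφ : IsDivergenceFunction φ) : Monotone (conj φ) := by
  intro s s' h
  refine iSup_mono fun t => ?_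
  rcases lt_or_ge t 0 with ht | ht
  · simp [hφ.eq_top_of_neg t ht]
  · exact EReal.sub_le_sub (mul_le_mul_of_nonneg_right h (by exact_mod_cast ht)) le_rfl

theorem le_conj (hφ : IsDivergenceFunction φ) (s : EReal) : s ≤ conj φ s := by
  refine le_trans ?_ (le_iSup (fun t : ℝ => s * (t : EReal) - (φ t : EReal)) 1)
  simp [hφ.map_one]

theorem conj_top (hφ : IsDivergenceFunction φ) : conj φ ⊤ = ⊤ := top_le_iff.1 (hφ.le_conj ⊤)

theorem conjPersp_top (hφ : IsDivergenceFunction φ) {η : ℝ} (hη : 0 ≤ η) :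
    conjPersp φ η ⊤ = ⊤ := by
  unfold conjPersp
  split_ifs with h h'
  · simp at h'
  · rfl
  · have h0 : 0 < η := lt_of_le_of_ne hη (Ne.symm h)
    rw [EReal.top_div_of_pos_ne_top (by exact_mod_cast h0) (EReal.coe_ne_top _), hφ.conj_top,
      EReal.coe_mul_top_of_pos h0]

theorem conjPersp_mono (hφ : IsDivergenceFunction φ) {η : ℝ} (hη : 0 ≤ η) :
    Monotone (conjPersp φ η) := by
  intro s s' h
  unfold conjPersp
  split_ifs with h0 h1
  · exact le_rfl
  · exact le_top
  · exact absurd (h.trans ‹s' ≤ 0›) ‹¬s ≤ 0›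
  · exact le_rfl
  · have h0' : (0 : EReal) ≤ (η : EReal) := by exact_mod_cast hη
    exact mul_le_mul_of_nonneg_left (hφ.conj_mono (EReal.div_le_div_right_of_nonneg h0' h)) h0'

theorem conjPersp_le_iff {η s y : ℝ} (hη : 0 < η) : conjPersp φ η s ≤ (y : EReal) ↔
    ∀ t, φ t < ⊤ → t * s - η * (φ t).toReal ≤ y := by
  unfold conjPersp
  rw [if_neg hη.ne', ← EReal.coe_div]
  have hpos : (0 : EReal) < (η : EReal) := by exact_mod_cast hη
  rw [mul_comm, ← EReal.le_div_iff_mul_le hpos (EReal.coe_ne_top _), ← EReal.coe_div, conj_le_iff]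
  refine forall_congr' fun t => imp_congr_right fun _ => ?_
  rw [le_div_iff₀ hη]
  have : (t * (s / η) - (φ t).toReal) * η = t * s - η * (φ t).toReal := by
    field_simp
  rw [this]

theorem conjPersp_zero_of_nonpos {s : EReal} (hs : s ≤ 0) : conjPersp φ 0 s = 0 := by
  simp [conjPersp, hs]

theorem le_conjPersp (hφ : IsDivergenceFunction φ) {η : ℝ} (hη : 0 ≤ η) (s : EReal) :
    s ≤ conjPersp φ η s := by
  rcases hη.eq_or_lt with rfl | h
  · unfold conjPersp
    rw [if_pos rfl]
    split_ifs with h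
    · exact h
    · exact le_top
  · have hpos : (0 : EReal) < (η : EReal) := by exact_mod_cast h
    unfold conjPersp
    rw [if_neg h.ne', ← EReal.div_le_iff_le_mul hpos (EReal.coe_ne_top _)]
    exact hφ.le_conj _

/-- A bound on the perspective of the conjugate entails the Fenchel inequality, also for `η = 0`,
where the convention on `0 φ*(s / 0)` is more restrictive than the limit `η → 0`. -/
theorem fenchel_of_conjPersp_le (hφ : IsDivergenceFunction φ) {η s y : ℝ} (hη : 0 ≤ η)
    (h : conjPersp φ η s ≤ (y : EReal)) {t : ℝ} (ht : φ t < ⊤) :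
    t * s - η * (φ t).toReal ≤ y := by
  rcases hη.eq_or_lt with rfl | hpos
  · unfold conjPersp at h
    rw [if_pos rfl] at h
    split_ifs at h with hs
    · have hs' : s ≤ 0 := by exact_mod_cast hs
      have hy : 0 ≤ y := by exact_mod_cast h
      nlinarith [hφ.nonneg_of_lt_top ht, mul_nonneg (hφ.nonneg_of_lt_top ht) (neg_nonneg.2 hs')]
    · simp at h
  · exact (conjPersp_le_iff hpos).1 h t ht

/-- A conjugate that takes the same real value at two points is constant, and hence minimal, to
the left of them: this is convexity. -/
theorem conj_le_of_eq (hφ : IsDivergenceFunction φ) {y y' h : ℝ} (hy : y' < y)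
    (h1 : conj φ y = h) (h2 : conj φ y' = h) (w : ℝ) : (h : EReal) ≤ conj φ w := by
  rcases le_or_gt y' w with hw | hw
  · exact h2 ▸ hφ.conj_mono (by exact_mod_cast hw)
  by_contra! hlt
  have hne : conj φ w ≠ ⊥ := by
    have := hφ.le_conj w
    intro h; rw [h] at this; simp at this
  set k := (conj φ w).toReal with hk
  have hkw : conj φ w = k := (EReal.coe_toReal (hlt.ne_top) hne).symm
  rw [hkw] at hlt
  have hkh : k < h := by exact_mod_cast hlt
  set l := (y - y') / (y - w) with hl
  have hl0 : 0 < l := div_pos (by linarith) (by linarith)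
  have hl1 : l ≤ 1 := (div_le_one (by linarith)).2 (by linarith)
  have hcomb : y' = l * w + (1 - l) * y := by
    have : y - w ≠ 0 := by linarith
    rw [hl]; field_simp; ring
  have : conj φ y' ≤ ((l * k + (1 - l) * h : ℝ) : EReal) := by
    rw [conj_le_iff]
    intro t ht
    have a1 := conj_le_iff.1 hkw.le t ht
    have a2 := conj_le_iff.1 h1.le t ht
    have b1 := mul_le_mul_of_nonneg_left a1 hl0.le
    have b2 := mul_le_mul_of_nonneg_left a2 (sub_nonneg.2 hl1)
    rw [hcomb]
    linarith
  rw [h2] at this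
  have : h ≤ l * k + (1 - l) * h := by exact_mod_cast this
  nlinarith

end IsDivergenceFunction


section DualIntegrand

variable {φ₁ φ₂ : ℝ → ℝ≥0∞}

theorem measurable_conj_coe (hφ : IsDivergenceFunction φ₁) :
    Measurable fun y : ℝ => conj φ₁ (y : EReal) :=
  (show Monotone fun y : ℝ => conj φ₁ (y : EReal) from
    fun _ _ h => hφ.conj_mono (by exact_mod_cast h)).measurable

theorem measurable_dualIntegrand (hφ₁ : IsDivergenceFunction φ₁) (hφ₂ : IsDivergenceFunction φ₂)
    (θ₁ θ₂ : ℝ) {η : ℝ} (hη : 0 ≤ η) :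
    Measurable fun x => dualIntegrand φ₁ φ₂ x θ₁ θ₂ η := by
  refine (show Antitone fun x => dualIntegrand φ₁ φ₂ x θ₁ θ₂ η from fun x x' h => ?_).measurable
  refine hφ₂.conjPersp_mono hη (add_le_add_left (hφ₁.conj_mono ?_) _)
  exact_mod_cast (by linarith : -θ₂ - x' ≤ -θ₂ - x)

theorem le_dualIntegrand (hφ₁ : IsDivergenceFunction φ₁) (hφ₂ : IsDivergenceFunction φ₂)
    (x θ₁ θ₂ : ℝ) {η : ℝ} (hη : 0 ≤ η) :
    ((-θ₂ - x + θ₁ : ℝ) : EReal) ≤ dualIntegrand φ₁ φ₂ x θ₁ θ₂ η := by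
  refine le_trans ?_ (hφ₂.le_conjPersp hη _)
  rw [EReal.coe_add]
  exact add_le_add_left (hφ₁.le_conj _) _

theorem exists_conj_eq_of_le {h : EReal} {y : ℝ} (hφ : IsDivergenceFunction φ₁) (b : ℝ)
    (hh : h = conj φ₁ y) (hb : h ≤ (b : EReal)) : ∃ a : ℝ, h = a := by
  refine ⟨h.toReal, (EReal.coe_toReal ?_ ?_).symm⟩
  · exact (lt_of_le_of_lt hb (EReal.coe_lt_top b)).ne
  · exact (lt_of_lt_of_le (EReal.bot_lt_coe y) (hh ▸ hφ.le_conj y)).ne'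

theorem exists_of_dualIntegrand_le (hφ₁ : IsDivergenceFunction φ₁)
    (hφ₂ : IsDivergenceFunction φ₂) {x θ₁ θ₂ η b : ℝ} (hη : 0 ≤ η)
    (hb : dualIntegrand φ₁ φ₂ x θ₁ θ₂ η ≤ (b : EReal)) :
    ∃ h : ℝ, conj φ₁ ((-θ₂ - x : ℝ) : EReal) = h ∧
      ∀ t, φ₂ t < ⊤ → t * (h + θ₁) - η * (φ₂ t).toReal ≤ b := by
  have hne : conj φ₁ ((-θ₂ - x : ℝ) : EReal) ≠ ⊤ := by
    intro h
    rw [dualIntegrand, h, EReal.top_add_coe, hφ₂.conjPersp_top hη] at hb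
    simp at hb
  have hbot : conj φ₁ ((-θ₂ - x : ℝ) : EReal) ≠ ⊥ :=
    (lt_of_lt_of_le (EReal.bot_lt_coe _) (hφ₁.le_conj _)).ne'
  refine ⟨(conj φ₁ ((-θ₂ - x : ℝ) : EReal)).toReal, (EReal.coe_toReal hne hbot).symm, ?_⟩
  intro t ht
  refine hφ₂.fenchel_of_conjPersp_le hη ?_ ht
  rwa [EReal.coe_add, EReal.coe_toReal hne hbot]

theorem dualIntegrand_le {x θ₁ θ₂ η b h : ℝ} (hη : 0 < η)
    (hh : conj φ₁ ((-θ₂ - x : ℝ) : EReal) = h)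
    (hb : ∀ t, φ₂ t < ⊤ → t * (h + θ₁) - η * (φ₂ t).toReal ≤ b) :
    dualIntegrand φ₁ φ₂ x θ₁ θ₂ η ≤ (b : EReal) := by
  rw [dualIntegrand, hh, ← EReal.coe_add]
  exact (conjPersp_le_iff hη).2 hb

theorem dualIntegrand_zero {x θ₁ θ₂ h : ℝ}
    (hh : conj φ₁ ((-θ₂ - x : ℝ) : EReal) = h) (hs : h + θ₁ ≤ 0) :
    dualIntegrand φ₁ φ₂ x θ₁ θ₂ 0 = 0 := by
  rw [dualIntegrand, hh, ← EReal.coe_add]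
  exact conjPersp_zero_of_nonpos (by exact_mod_cast hs)

end DualIntegrand

/-! ### Weak duality -/

theorem absolutelyContinuous_of_phiDivergence_le {Ω : Type*} [MeasurableSpace Ω]
    {φ : ℝ → ℝ≥0∞} {Q P : Measure Ω} {r : ℝ} (h : phiDivergence φ Q P ≤ ENNReal.ofReal r) :
    Q ≪ P := by
  by_contra hne
  rw [phiDivergence, if_neg hne] at h
  exact absurd h (by simp)

theorem integrable_of_max_of_neg_le {α : Type*} [MeasurableSpace α] {μ : Measure α} {f R : α → ℝ}
    (hf : AEStronglyMeasurable f μ) (hp : Integrable (fun a => max (f a) 0) μ)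
    (hR : Integrable R μ) (h : ∀ᵐ a ∂μ, -f a ≤ R a) : Integrable f μ := by
  refine (hp.add hR.abs).mono' hf ?_
  filter_upwards [h] with a ha
  simp only [Pi.add_apply, Real.norm_eq_abs]
  rcases le_total 0 (f a) with h | h
  · rw [abs_of_nonneg h, max_eq_left h]; linarith [abs_nonneg (R a)]
  · rw [abs_of_nonpos h, max_eq_right h]; linarith [le_abs_self (R a)]

theorem robustShortfall_le {Ω : Type*} [MeasurableSpace Ω]
    {P₀ : Measure Ω} [IsProbabilityMeasure P₀] {X : Ω → ℝ} (hX : Integrable X P₀)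
    {φ₁ φ₂ : ℝ → ℝ≥0∞} (hφ₁ : IsDivergenceFunction φ₁) (hφ₂ : IsDivergenceFunction φ₂)
    (hm₁ : Measurable φ₁) (hm₂ : Measurable φ₂) {r : ℝ} (hr : 0 ≤ r)
    {θ₁ θ₂ η : ℝ} (hη : 0 ≤ η)
    (hfeas : extIntegral P₀ (fun ω => dualIntegrand φ₁ φ₂ (X ω) θ₁ θ₂ η) ≤
      ((θ₁ - η * r : ℝ) : EReal)) :
    robustShortfall φ₁ φ₂ P₀ r X ≤ (θ₂ : EReal) := by
  obtain ⟨F, hF, hFeq, hFle⟩ := exists_integrable_of_extIntegral_le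
    ((measurable_dualIntegrand hφ₁ hφ₂ θ₁ θ₂ hη).comp_aemeasurable hX.aemeasurable)
    (g := fun ω => -θ₂ - X ω + θ₁) (((integrable_const _).sub hX).add (integrable_const _))
    (Filter.Eventually.of_forall fun ω => le_dualIntegrand hφ₁ hφ₂ (X ω) θ₁ θ₂ hη) hfeas
  refine iSup_le fun c => iSup_le fun hc => iSup_le fun Q => iSup_le fun hQ => iSup_le fun hI =>
    iSup_le fun Q' => iSup_le fun hQ' => iSup_le fun hac => ?_
  have hQP : Q ≪ P₀ := absolutelyContinuous_of_phiDivergence_le hI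
  rw [phiDivergence, if_pos hQP] at hI
  rw [phiDivergence, if_pos hac]
  by_cases htop : ∫⁻ ω, scaledDivergence φ₁ c (Q'.rnDeriv Q ω).toReal ∂Q = ⊤
  · rw [htop, EReal.coe_ennreal_top, EReal.sub_top]; exact bot_le
  by_cases hneg : ∫⁻ ω, (-((-X ω : ℝ) : EReal)).toENNReal ∂Q' = ⊤
  · rw [extIntegral, hneg, EReal.coe_ennreal_top, EReal.sub_top, EReal.bot_sub]; exact bot_le
  set q : Ω → ℝ := fun ω => (Q.rnDeriv P₀ ω).toReal with hq
  set Z : Ω → ℝ := fun ω => (Q'.rnDeriv Q ω).toReal with hZ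
  have hqm : Measurable q := (Measure.measurable_rnDeriv Q P₀).ennreal_toReal
  have hZm : Measurable Z := (Measure.measurable_rnDeriv Q' Q).ennreal_toReal
  have hq0 : ∀ ω, 0 ≤ q ω := fun ω => ENNReal.toReal_nonneg
  have hZ0 : ∀ ω, 0 ≤ Z ω := fun ω => ENNReal.toReal_nonneg
  have hsm : Measurable fun ω => scaledDivergence φ₁ c (Z ω) :=
    (hm₁.comp (hZm.div_const c)).const_mul _
  -- integrals against `Q'` and `Q` become integrals against `P₀`
  have iff' : ∀ f : Ω → ℝ, Integrable (fun ω => q ω * (Z ω * f ω)) P₀ ↔ Integrable f Q' := by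
    intro f
    rw [← integrable_rnDeriv_smul_iff hac, ← integrable_rnDeriv_smul_iff hQP]; rfl
  have int' : ∀ f : Ω → ℝ, ∫ ω, q ω * (Z ω * f ω) ∂P₀ = ∫ ω, f ω ∂Q' := by
    intro f
    rw [← integral_rnDeriv_smul hac, ← integral_rnDeriv_smul hQP]; rfl
  have iff1 : ∀ f : Ω → ℝ, Integrable (fun ω => q ω * f ω) P₀ ↔ Integrable f Q := fun f => by
    rw [← integrable_rnDeriv_smul_iff hQP]; rfl
  have int1 : ∀ f : Ω → ℝ, ∫ ω, q ω * f ω ∂P₀ = ∫ ω, f ω ∂Q := fun f => by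
    rw [← integral_rnDeriv_smul hQP]; rfl
  have hqi : Integrable q P₀ := Measure.integrable_toReal_rnDeriv
  have hq1 : ∫ ω, q ω ∂P₀ = 1 := by simpa using int1 fun _ => 1
  have hqZi : Integrable (fun ω => q ω * (Z ω * 1)) P₀ := (iff' fun _ => 1).2 (integrable_const _)
  have hqZ1 : ∫ ω, q ω * (Z ω * 1) ∂P₀ = 1 := by simpa using int' fun _ => 1
  -- the two penalty terms
  have hJi : Integrable (fun ω => (scaledDivergence φ₁ c (Z ω)).toReal) Q :=
    integrable_toReal_of_lintegral_ne_top hsm.aemeasurable htop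
  have hJint : ∫ ω, (scaledDivergence φ₁ c (Z ω)).toReal ∂Q =
      (∫⁻ ω, scaledDivergence φ₁ c (Z ω) ∂Q).toReal :=
    integral_toReal hsm.aemeasurable (ae_lt_top hsm htop)
  have hI' : ∫⁻ ω, φ₂ (q ω) ∂P₀ ≠ ⊤ := ne_top_of_le_ne_top ENNReal.ofReal_ne_top hI
  have hKi : Integrable (fun ω => (φ₂ (q ω)).toReal) P₀ :=
    integrable_toReal_of_lintegral_ne_top (hm₂.comp hqm).aemeasurable hI'
  have hKint : ∫ ω, (φ₂ (q ω)).toReal ∂P₀ ≤ r := by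
    rw [show ∫ ω, (φ₂ (q ω)).toReal ∂P₀ = (∫⁻ ω, φ₂ (q ω) ∂P₀).toReal from
      integral_toReal (hm₂.comp hqm).aemeasurable (ae_lt_top (hm₂.comp hqm) hI')]
    exact ENNReal.toReal_le_of_le_ofReal hr hI
  set G : Ω → ℝ := fun ω => F ω + η * (φ₂ (q ω)).toReal - θ₁ * q ω with hG
  have hFK : Integrable (fun ω => F ω + η * (φ₂ (q ω)).toReal) P₀ := hF.add (hKi.const_mul η)
  have hGi : Integrable G P₀ := hFK.sub (hqi.const_mul θ₁)
  have hGint : ∫ ω, G ω ∂P₀ ≤ 0 := by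
    simp only [hG]
    rw [integral_sub hFK (hqi.const_mul θ₁),
      integral_add hF (hKi.const_mul η), integral_const_mul, integral_const_mul, hq1]
    nlinarith [mul_le_mul_of_nonneg_left hKint hη]
  set R : Ω → ℝ := fun ω => q ω * (scaledDivergence φ₁ c (Z ω)).toReal + c * G ω +
    θ₂ * (q ω * (Z ω * 1)) with hR
  have hJi' := (iff1 _).2 hJi
  have hJG : Integrable (fun ω => q ω * (scaledDivergence φ₁ c (Z ω)).toReal + c * G ω) P₀ :=
    hJi'.add (hGi.const_mul c)
  have hRi : Integrable R P₀ := hJG.add (hqZi.const_mul θ₂)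
  have hRint : ∫ ω, R ω ∂P₀ ≤ (∫⁻ ω, scaledDivergence φ₁ c (Z ω) ∂Q).toReal + θ₂ := by
    simp only [hR]
    rw [integral_add hJG (hqZi.const_mul θ₂),
      integral_add hJi' (hGi.const_mul c), integral_const_mul, integral_const_mul, hqZ1, int1,
      hJint]
    nlinarith
  have hfinQ : ∀ᵐ ω ∂P₀, q ω ≠ 0 → scaledDivergence φ₁ c (Z ω) < ⊤ := by
    have h1 := ae_lt_top hsm htop
    rw [← Measure.withDensity_rnDeriv_eq Q P₀ hQP,
      ae_withDensity_iff (Measure.measurable_rnDeriv Q P₀)] at h1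
    filter_upwards [h1] with ω hω h0
    exact hω fun h => h0 (by simp [hq, h])
  have hle : ∀ᵐ ω ∂P₀, -(q ω * (Z ω * X ω)) ≤ R ω := by
    filter_upwards [hFeq, hfinQ, ae_lt_top (hm₂.comp hqm) hI'] with ω h1 h2 h3
    obtain ⟨h, hh, hfen⟩ := exists_of_dualIntegrand_le hφ₁ hφ₂ hη h1.le
    have hGh : q ω * h ≤ G ω := by
      have := hfen (q ω) h3
      simp only [hG]; linarith
    have hcGh := mul_le_mul_of_nonneg_left hGh hc.le
    rcases eq_or_ne (q ω) 0 with h0 | h0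
    · rw [h0] at hcGh
      simp only [hR, h0]; linarith
    · have h4 := h2 h0
      have h5 : φ₁ (Z ω / c) < ⊤ := by
        refine lt_top_iff_ne_top.2 fun h => ?_
        simp [scaledDivergence, h, ENNReal.mul_top, hc] at h4
      have h6 := conj_le_iff.1 hh.le _ h5
      have h7 : (scaledDivergence φ₁ c (Z ω)).toReal = c * (φ₁ (Z ω / c)).toReal := by
        rw [scaledDivergence, ENNReal.toReal_mul, ENNReal.toReal_ofReal hc.le]
      have h8 : Z ω * (-θ₂ - X ω) ≤ (scaledDivergence φ₁ c (Z ω)).toReal + c * h := by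
        rw [h7]
        have := mul_le_mul_of_nonneg_left h6 hc.le
        have e : c * (Z ω / c * (-θ₂ - X ω) - (φ₁ (Z ω / c)).toReal) =
          Z ω * (-θ₂ - X ω) - c * (φ₁ (Z ω / c)).toReal := by field_simp
        linarith
      have h9 := mul_le_mul_of_nonneg_left h8 (hq0 ω)
      simp only [hR]; linarith
  have hXp : Integrable (fun ω => max (X ω) 0) Q' := by
    have hXm : AEMeasurable X Q' := hX.aemeasurable.mono_ac (hac.trans hQP)
    have : ∫⁻ ω, ENNReal.ofReal (X ω) ∂Q' ≠ ⊤ := by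
      convert hneg using 4 with ω
      rw [EReal.coe_neg, neg_neg, EReal.toENNReal_of_ne_top (EReal.coe_ne_top _),
        EReal.toReal_coe]
    refine (integrable_toReal_of_lintegral_ne_top hXm.ennreal_ofReal this).congr ?_
    exact Filter.Eventually.of_forall fun ω => ENNReal.toReal_ofReal'
  have hXi : Integrable (fun ω => q ω * (Z ω * X ω)) P₀ := by
    refine integrable_of_max_of_neg_le ?_ ?_ hRi hle
    · exact hqm.aestronglyMeasurable.mul (hZm.aestronglyMeasurable.mul hX.aestronglyMeasurable)
    · refine ((iff' _).2 hXp).congr (Filter.Eventually.of_forall fun ω => ?_)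
      have := mul_nonneg (hq0 ω) (hZ0 ω)
      dsimp only
      rw [← mul_assoc, ← mul_assoc, mul_max_of_nonneg _ _ this, mul_zero]
  have hXQ' : Integrable X Q' := (iff' _).1 hXi
  have hfinal : ∫ ω, -X ω ∂Q' ≤ (∫⁻ ω, scaledDivergence φ₁ c (Z ω) ∂Q).toReal + θ₂ := by
    rw [integral_neg, ← int', ← integral_neg]
    exact (integral_mono_ae hXi.neg hRi hle).trans hRint
  rw [show extIntegral Q' (fun ω => ((-X ω : ℝ) : EReal)) = ((∫ ω, -X ω ∂Q' : ℝ) : EReal) from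
    extIntegral_coe hXQ'.neg, ← EReal.coe_ennreal_toReal htop, ← EReal.coe_sub]
  exact_mod_cast sub_le_iff_le_add'.2 hfinal

/-! ### Feasible densities -/

section Density

variable {Ω : Type*} [MeasurableSpace Ω] {P : Measure Ω} {q : Ω → ℝ}

theorem isProbabilityMeasure_withDensity_ofReal (hq0 : ∀ ω, 0 ≤ q ω) (hqi : Integrable q P)
    (hq1 : ∫ ω, q ω ∂P = 1) :
    IsProbabilityMeasure (P.withDensity fun ω => ENNReal.ofReal (q ω)) := by
  constructor
  rw [withDensity_apply _ MeasurableSet.univ, setLIntegral_univ,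
    ← ofReal_integral_eq_lintegral_ofReal hqi (Filter.Eventually.of_forall hq0), hq1,
    ENNReal.ofReal_one]

theorem phiDivergence_withDensity_ofReal [SigmaFinite P] (φ : ℝ → ℝ≥0∞) (hq0 : ∀ ω, 0 ≤ q ω)
    (hqm : Measurable q) :
    phiDivergence φ (P.withDensity fun ω => ENNReal.ofReal (q ω)) P = ∫⁻ ω, φ (q ω) ∂P := by
  rw [phiDivergence, if_pos (withDensity_absolutelyContinuous _ _)]
  refine lintegral_congr_ae ?_
  filter_upwards [Measure.rnDeriv_withDensity P hqm.ennreal_ofReal] with ω h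
  rw [h, ENNReal.toReal_ofReal (hq0 ω)]

theorem integral_withDensity_ofReal (hq0 : ∀ ω, 0 ≤ q ω) (hqm : Measurable q) (f : Ω → ℝ) :
    ∫ ω, f ω ∂(P.withDensity fun ω => ENNReal.ofReal (q ω)) = ∫ ω, q ω * f ω ∂P := by
  rw [integral_withDensity_eq_integral_toReal_smul hqm.ennreal_ofReal
    (Filter.Eventually.of_forall fun _ => ENNReal.ofReal_lt_top)]
  simp [ENNReal.toReal_ofReal (hq0 _)]

theorem integrable_withDensity_ofReal_iff (hq0 : ∀ ω, 0 ≤ q ω) (hqm : Measurable q) (f : Ω → ℝ) :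
    Integrable f (P.withDensity fun ω => ENNReal.ofReal (q ω)) ↔
      Integrable (fun ω => q ω * f ω) P := by
  rw [integrable_withDensity_iff_integrable_smul' hqm.ennreal_ofReal
    (Filter.Eventually.of_forall fun _ => ENNReal.ofReal_lt_top)]
  simp [ENNReal.toReal_ofReal (hq0 _)]

theorem integrable_mul_of_bounded {f : Ω → ℝ} (hqm : Measurable q) (hq0 : ∀ ω, 0 ≤ q ω)
    {M : ℝ} (hM : ∀ ω, q ω ≤ M) (hf : Integrable f P) : Integrable (fun ω => q ω * f ω) P :=
  hf.bdd_mul hqm.aestronglyMeasurable (c := M)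
    (Filter.Eventually.of_forall fun ω => by rw [Real.norm_eq_abs, abs_of_nonneg (hq0 ω)]; exact hM ω)

end Density

/-- The factor `c` in the definition of the risk measure makes the inner problem homogeneous: an
upper bound on the risk measure yields an inequality for every nonnegative bounded `z`, whatever
its expectation. The measures used have density `q` and relative density `z / m`, with
`m = E[q z]` and `c = 1 / m`. -/
theorem integral_mul_le_zero_of_robustShortfall_le {Ω : Type*} [MeasurableSpace Ω]
    {P₀ : Measure Ω} [IsProbabilityMeasure P₀] {X : Ω → ℝ} (hX : Integrable X P₀)
    {φ₁ φ₂ : ℝ → ℝ≥0∞} (hm₁ : Measurable φ₁) {r θ₂ : ℝ}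
    (hρ : robustShortfall φ₁ φ₂ P₀ r X ≤ (θ₂ : EReal))
    {q z : Ω → ℝ} (hqm : Measurable q) (hq0 : ∀ ω, 0 ≤ q ω) {M : ℝ} (hM : ∀ ω, q ω ≤ M)
    (hq1 : ∫ ω, q ω ∂P₀ = 1) (hqr : ∫⁻ ω, φ₂ (q ω) ∂P₀ ≤ ENNReal.ofReal r)
    (hzm : Measurable z) (hz0 : ∀ ω, 0 ≤ z ω) {M' : ℝ} (hM' : ∀ ω, z ω ≤ M')
    (hzφ : ∀ ω, φ₁ (z ω) < ⊤) {B : ℝ} (hB : ∀ ω, (φ₁ (z ω)).toReal ≤ B) :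
    ∫ ω, q ω * (z ω * (-θ₂ - X ω) - (φ₁ (z ω)).toReal) ∂P₀ ≤ 0 := by
  have hqi : Integrable q P₀ := by
    simpa using integrable_mul_of_bounded hqm hq0 hM (integrable_const (1 : ℝ))
  have hqzi : Integrable (fun ω => q ω * z ω) P₀ := by
    simpa [mul_comm] using integrable_mul_of_bounded hzm hz0 hM' hqi
  have hφm : Measurable fun ω => (φ₁ (z ω)).toReal := (hm₁.comp hzm).ennreal_toReal
  have hqφi : Integrable (fun ω => q ω * (φ₁ (z ω)).toReal) P₀ := by
    simpa [mul_comm] using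
      integrable_mul_of_bounded hφm (fun _ => ENNReal.toReal_nonneg) hB hqi
  have hqX : Integrable (fun ω => q ω * (z ω * X ω)) P₀ :=
    integrable_mul_of_bounded hqm hq0 hM (integrable_mul_of_bounded hzm hz0 hM' hX)
  have hqz0 : ∀ ω, 0 ≤ q ω * z ω := fun ω => mul_nonneg (hq0 ω) (hz0 ω)
  rcases (integral_nonneg (μ := P₀) (f := fun ω => q ω * z ω) hqz0).eq_or_lt with hm | hm
  · refine integral_nonpos_of_ae ?_
    filter_upwards [(integral_eq_zero_iff_of_nonneg hqz0 hqzi).1 hm.symm] with ω hω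
    have h1 : q ω * z ω = 0 := hω
    have h2 := mul_nonneg (hq0 ω) (ENNReal.toReal_nonneg (a := φ₁ (z ω)))
    have h3 : q ω * (z ω * (-θ₂ - X ω) - (φ₁ (z ω)).toReal) =
      q ω * z ω * (-θ₂ - X ω) - q ω * (φ₁ (z ω)).toReal := by ring
    rw [h3, h1]; simpa using h2
  set m := ∫ ω, q ω * z ω ∂P₀ with hmdef
  set Q := P₀.withDensity fun ω => ENNReal.ofReal (q ω) with hQ
  have hQp : IsProbabilityMeasure Q := isProbabilityMeasure_withDensity_ofReal hq0 hqi hq1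
  have hw0 : ∀ ω, 0 ≤ z ω / m := fun ω => div_nonneg (hz0 ω) hm.le
  have hwm : Measurable fun ω => z ω / m := hzm.div_const m
  have hwi : Integrable (fun ω => z ω / m) Q := by
    rw [integrable_withDensity_ofReal_iff hq0 hqm]
    simpa [mul_div_assoc] using hqzi.div_const m
  have hw1 : ∫ ω, z ω / m ∂Q = 1 := by
    rw [integral_withDensity_ofReal hq0 hqm]
    simp only [← mul_div_assoc]
    rw [integral_div, div_self hm.ne']
  set Q' := Q.withDensity fun ω => ENNReal.ofReal (z ω / m) with hQ'
  have hQ'p : IsProbabilityMeasure Q' := isProbabilityMeasure_withDensity_ofReal hw0 hwi hw1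
  have hXQ' : Integrable (fun ω => -X ω) Q' := by
    rw [integrable_withDensity_ofReal_iff hw0 hwm, integrable_withDensity_ofReal_iff hq0 hqm]
    refine (hqX.const_mul (-1 / m)).congr (Filter.Eventually.of_forall fun ω => ?_)
    dsimp only; ring
  have hφQ : Integrable (fun ω => 1 / m * (φ₁ (z ω)).toReal) Q := by
    rw [integrable_withDensity_ofReal_iff hq0 hqm]
    refine (hqφi.const_mul (1 / m)).congr (Filter.Eventually.of_forall fun ω => ?_)
    dsimp only; ring
  have key : extIntegral Q' (fun ω => ((-X ω : ℝ) : EReal)) -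
      (phiDivergence (scaledDivergence φ₁ (1 / m)) Q' Q : EReal) ≤ (θ₂ : EReal) := by
    simp only [robustShortfall, iSup_le_iff] at hρ
    refine hρ (1 / m) (by positivity) Q hQp ?_ Q' hQ'p (withDensity_absolutelyContinuous _ _)
    rwa [hQ, phiDivergence_withDensity_ofReal φ₂ hq0 hqm]
  have hpen : phiDivergence (scaledDivergence φ₁ (1 / m)) Q' Q =
      ENNReal.ofReal (∫ ω, 1 / m * (φ₁ (z ω)).toReal ∂Q) := by
    rw [hQ', phiDivergence_withDensity_ofReal _ hw0 hwm,
      ofReal_integral_eq_lintegral_ofReal hφQ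
        (Filter.Eventually.of_forall fun ω => by positivity)]
    refine lintegral_congr fun ω => ?_
    rw [scaledDivergence, ENNReal.ofReal_mul (by positivity), ENNReal.ofReal_toReal (hzφ ω).ne]
    congr 2
    field_simp
  rw [extIntegral_coe hXQ', hpen, EReal.coe_ennreal_ofReal,
    max_eq_left (integral_nonneg fun ω => by positivity), ← EReal.coe_sub,
    EReal.coe_le_coe_iff, integral_withDensity_ofReal hw0 hwm,
    integral_withDensity_ofReal hq0 hqm, integral_withDensity_ofReal hq0 hqm] at key
  have e1 : ∫ ω, q ω * (z ω / m * -X ω) ∂P₀ = -(1 / m) * ∫ ω, q ω * (z ω * X ω) ∂P₀ := by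
    rw [← integral_const_mul]; congr 1; ext ω; ring
  have e2 : ∫ ω, q ω * (1 / m * (φ₁ (z ω)).toReal) ∂P₀ =
      1 / m * ∫ ω, q ω * (φ₁ (z ω)).toReal ∂P₀ := by
    rw [← integral_const_mul]; congr 1; ext ω; ring
  have e3 : ∫ ω, q ω * (z ω * (-θ₂ - X ω) - (φ₁ (z ω)).toReal) ∂P₀ =
      -θ₂ * m - ∫ ω, q ω * (z ω * X ω) ∂P₀ - ∫ ω, q ω * (φ₁ (z ω)).toReal ∂P₀ := by
    have hi : Integrable (fun ω => -θ₂ * (q ω * z ω) - q ω * (z ω * X ω)) P₀ :=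
      (hqzi.const_mul _).sub hqX
    rw [hmdef, ← integral_const_mul, ← integral_sub (hqzi.const_mul _) hqX,
      ← integral_sub hi hqφi]
    congr 1; ext ω; ring
  rw [e1, e2] at key
  rw [e3]
  have h := mul_le_mul_of_nonneg_left key hm.le
  have e4 : m * (-(1 / m) * ∫ ω, q ω * (z ω * X ω) ∂P₀ -
      1 / m * ∫ ω, q ω * (φ₁ (z ω)).toReal ∂P₀) =
      -∫ ω, q ω * (z ω * X ω) ∂P₀ - ∫ ω, q ω * (φ₁ (z ω)).toReal ∂P₀ := by
    field_simp
  rw [e4] at h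
  linarith

/-! ### Lagrange multipliers -/

theorem nonpos_of_forall_mul_le {a K : ℝ} (h : ∀ k, 0 ≤ k → k * a ≤ K) : a ≤ 0 := by
  by_contra! ha
  have := h ((|K| + 1) / a) (by positivity)
  rw [div_mul_cancel₀ _ ha.ne'] at this
  linarith [le_abs_self K]

/-- Lagrange multipliers `θ₁` for the constraint `E[q] = 1` and `η ≥ 0` for `E[φ(q)] ≤ r`, for the
maximization of `sup_n E[q H_n]`. They come from separating `(0, 1, r)` from the convex set of
attainable triples `(E[q H_n], E[q], E[φ(q)])`; the constraint qualification is that constants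
near `1` are in the domain of `φ` and that `0 < r`. -/
theorem exists_multipliers {Ω : Type*} [MeasurableSpace Ω]
    {P : Measure Ω} [IsProbabilityMeasure P] {φ : ℝ → ℝ≥0∞} (hφ : IsDivergenceFunction φ)
    (hm : Measurable φ) {r : ℝ} (hr : 0 < r) {H : ℕ → Ω → ℝ} (hH : ∀ n, Integrable (H n) P)
    (hmono : ∀ ω, Monotone fun n => H n ω)
    (hle : ∀ n (q : Ω → ℝ), Measurable q → (∀ ω, 0 ≤ q ω) → (∃ M, ∀ ω, q ω ≤ M) →
      ∫ ω, q ω ∂P = 1 → ∫⁻ ω, φ (q ω) ∂P ≤ ENNReal.ofReal r → ∫ ω, q ω * H n ω ∂P ≤ 0) :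
    ∃ θ₁ η : ℝ, 0 ≤ η ∧ ∀ n (q : Ω → ℝ), Measurable q → (∀ ω, 0 ≤ q ω) →
      (∃ M, ∀ ω, q ω ≤ M) → ∫⁻ ω, φ (q ω) ∂P ≠ ⊤ →
      ∫ ω, q ω * H n ω ∂P + θ₁ * ∫ ω, q ω ∂P - η * (∫⁻ ω, φ (q ω) ∂P).toReal ≤ θ₁ - η * r := by
  let C : Set (ℝ × ℝ × ℝ) := {p | ∃ n, ∃ q : Ω → ℝ, Measurable q ∧ (∀ ω, 0 ≤ q ω) ∧
    (∃ M, ∀ ω, q ω ≤ M) ∧ p.1 ≤ ∫ ω, q ω * H n ω ∂P ∧ ∫ ω, q ω ∂P = p.2.1 ∧ 0 ≤ p.2.2 ∧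
    ∫⁻ ω, φ (q ω) ∂P ≤ ENNReal.ofReal p.2.2}
  have hconv : Convex ℝ C := by
    rintro ⟨u, v, w⟩ ⟨n, q, hqm, hq0, ⟨M, hM⟩, h1, h2, h3, h4⟩ ⟨u', v', w'⟩
      ⟨n', q', hqm', hq0', ⟨M', hM'⟩, h1', h2', h3', h4'⟩ a b ha hb hab
    dsimp only at h1 h2 h3 h4 h1' h2' h3' h4'
    have hqi : Integrable q P := by
      simpa using integrable_mul_of_bounded hqm hq0 hM (integrable_const (1 : ℝ))
    have hqi' : Integrable q' P := by
      simpa using integrable_mul_of_bounded hqm' hq0' hM' (integrable_const (1 : ℝ))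
    have hi := integrable_mul_of_bounded hqm hq0 hM (hH (max n n'))
    have hi' := integrable_mul_of_bounded hqm' hq0' hM' (hH (max n n'))
    refine ⟨max n n', fun ω => a * q ω + b * q' ω, (hqm.const_mul a).add (hqm'.const_mul b),
      fun ω => add_nonneg (mul_nonneg ha (hq0 ω)) (mul_nonneg hb (hq0' ω)),
      ⟨a * M + b * M', fun ω => add_le_add (mul_le_mul_of_nonneg_left (hM ω) ha)
        (mul_le_mul_of_nonneg_left (hM' ω) hb)⟩, ?_, ?_, ?_, ?_⟩
    · have e : ∫ ω, (a * q ω + b * q' ω) * H (max n n') ω ∂P =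
          a * ∫ ω, q ω * H (max n n') ω ∂P + b * ∫ ω, q' ω * H (max n n') ω ∂P := by
        rw [← integral_const_mul, ← integral_const_mul,
          ← integral_add (hi.const_mul a) (hi'.const_mul b)]
        congr 1; ext ω; ring
      have g : u ≤ ∫ ω, q ω * H (max n n') ω ∂P :=
        h1.trans (integral_mono (integrable_mul_of_bounded hqm hq0 hM (hH n)) hi fun ω =>
          mul_le_mul_of_nonneg_left (hmono ω (le_max_left _ _)) (hq0 ω))
      have g' : u' ≤ ∫ ω, q' ω * H (max n n') ω ∂P :=
        h1'.trans (integral_mono (integrable_mul_of_bounded hqm' hq0' hM' (hH n')) hi' fun ω =>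
          mul_le_mul_of_nonneg_left (hmono ω (le_max_right _ _)) (hq0' ω))
      rw [e]
      exact add_le_add (mul_le_mul_of_nonneg_left g ha) (mul_le_mul_of_nonneg_left g' hb)
    · rw [integral_add (hqi.const_mul a) (hqi'.const_mul b), integral_const_mul,
        integral_const_mul, h2, h2']
      rfl
    · exact add_nonneg (mul_nonneg ha h3) (mul_nonneg hb h3')
    · refine (lintegral_mono fun ω => hφ.le_add ha hb hab (q ω) (q' ω)).trans ?_
      have g : Measurable fun ω => φ (q ω) := hm.comp hqm
      have g' : Measurable fun ω => φ (q' ω) := hm.comp hqm'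
      rw [lintegral_add_left (g.const_mul _), lintegral_const_mul _ g, lintegral_const_mul _ g']
      refine (add_le_add (mul_le_mul_right h4 _) (mul_le_mul_right h4' _)).trans ?_
      rw [← ENNReal.ofReal_mul ha, ← ENNReal.ofReal_mul hb,
        ← ENNReal.ofReal_add (mul_nonneg ha h3) (mul_nonneg hb h3')]
      rfl
  obtain ⟨δ, hδ0, hδ1, hδ⟩ := hφ.exists_Icc_lt_top
  set M₀ := (φ (1 - δ)).toReal + (φ (1 + δ)).toReal with hM₀
  have hM₀0 : 0 ≤ M₀ := add_nonneg ENNReal.toReal_nonneg ENNReal.toReal_nonneg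
  have hφM : ∀ v ∈ Set.Ioo (1 - δ) (1 + δ), φ v ≤ ENNReal.ofReal M₀ := by
    intro v hv
    have f1 := hδ (1 - δ) ⟨le_rfl, by linarith⟩
    have f2 := hδ (1 + δ) ⟨by linarith, le_rfl⟩
    rw [hM₀, ENNReal.ofReal_add ENNReal.toReal_nonneg ENNReal.toReal_nonneg,
      ENNReal.ofReal_toReal f1.ne, ENNReal.ofReal_toReal f2.ne]
    rcases le_total v 1 with h | h
    · refine le_trans ?_ le_self_add
      have e : (1 - (v - (1 - δ)) / δ) * (1 - δ) + (v - (1 - δ)) / δ * 1 = v := by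
        field_simp; ring
      have := hφ.lineMap_one_le (a := (v - (1 - δ)) / δ) (t := 1 - δ)
        (div_nonneg (by linarith [hv.1]) hδ0.le) ((div_le_one hδ0).2 (by linarith))
      rwa [e] at this
    · refine le_trans ?_ le_add_self
      have e : (1 - (1 + δ - v) / δ) * (1 + δ) + (1 + δ - v) / δ * 1 = v := by
        field_simp; ring
      have := hφ.lineMap_one_le (a := (1 + δ - v) / δ) (t := 1 + δ)
        (div_nonneg (by linarith [hv.2]) hδ0.le) ((div_le_one hδ0).2 (by linarith))
      rwa [e] at this
  set u₀ := -(2 * |∫ ω, H 0 ω ∂P|) with hu₀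
  have hbox : ∀ u v w : ℝ, u < u₀ → v ∈ Set.Ioo (1 - δ) (1 + δ) → M₀ < w → (u, v, w) ∈ C := by
    intro u v w hu hv hw
    have hv0 : 0 ≤ v := by linarith [hv.1]
    refine ⟨0, fun _ => v, measurable_const, fun _ => hv0, ⟨v, fun _ => le_rfl⟩, ?_, by simp,
      (hM₀0.trans hw.le), ?_⟩
    · dsimp only
      rw [integral_const_mul]
      have : -(2 * |∫ ω, H 0 ω ∂P|) ≤ v * ∫ ω, H 0 ω ∂P := by
        have h1 := neg_abs_le (∫ ω, H 0 ω ∂P)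
        have h2 := abs_nonneg (∫ ω, H 0 ω ∂P)
        have h3 := mul_le_mul_of_nonneg_left h1 hv0
        nlinarith [hv.2]
      linarith
    · simp only [lintegral_const, measure_univ, mul_one]
      exact (hφM v hv).trans (ENNReal.ofReal_le_ofReal hw.le)
  have hint : (interior C).Nonempty := by
    refine ⟨(u₀ - 1, 1, M₀ + 1), mem_interior.2
      ⟨Set.Iio u₀ ×ˢ Set.Ioo (1 - δ) (1 + δ) ×ˢ Set.Ioi M₀, ?_, ?_, ?_⟩⟩
    · rintro ⟨u, v, w⟩ ⟨h1, h2, h3⟩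
      exact hbox u v w h1 h2 h3
    · exact isOpen_Iio.prod (isOpen_Ioo.prod isOpen_Ioi)
    · refine ⟨?_, ⟨?_, ?_⟩, ?_⟩ <;> simp [hδ0]
  have hnot : ((0, 1, r) : ℝ × ℝ × ℝ) ∉ interior C := by
    intro h
    have hc : Continuous fun t : ℝ => ((t, 1, r) : ℝ × ℝ × ℝ) := by fun_prop
    have hev : ∀ᶠ t in 𝓝 (0 : ℝ), ((t, 1, r) : ℝ × ℝ × ℝ) ∈ C :=
      hc.continuousAt.eventually (mem_interior_iff_mem_nhds.1 h)
    obtain ⟨t, ⟨n, q, hqm, hq0, hM, h1, h2, h3, h4⟩, ht⟩ :=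
      ((hev.filter_mono nhdsWithin_le_nhds).and
        (self_mem_nhdsWithin : Set.Ioi (0 : ℝ) ∈ 𝓝[>] 0)).exists
    exact absurd (h1.trans (hle n q hqm hq0 hM h2 h4)) (not_le.2 ht)
  obtain ⟨f, hf0, hf⟩ := geometric_hahn_banach_of_nonempty_interior_point hconv hnot hint
  set a := f (1, 0, 0) with ha
  set b := f (0, 1, 0) with hb
  set d := f (0, 0, 1) with hd
  have hfeq : ∀ u v w : ℝ, f (u, v, w) = u * a + v * b + w * d := by
    intro u v w
    have : ((u, v, w) : ℝ × ℝ × ℝ) = u • (1, 0, 0) + v • (0, 1, 0) + w • (0, 0, 1) := by simp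
    rw [this, map_add, map_add, map_smul, map_smul, map_smul]
    rfl
  have hsep : ∀ u v w : ℝ, (u, v, w) ∈ C → u * a + v * b + w * d ≤ b + r * d := by
    intro u v w h
    have := hf _ h
    rw [hfeq, hfeq] at this
    linarith
  have h1mem : (1 : ℝ) ∈ Set.Ioo (1 - δ) (1 + δ) := ⟨by linarith, by linarith⟩
  have ha0 : -a ≤ 0 := by
    refine nonpos_of_forall_mul_le (K := r * d - (M₀ + 1) * d - (u₀ - 1) * a) fun k hk => ?_
    have := hsep (u₀ - 1 - k) 1 (M₀ + 1) (hbox _ _ _ (by linarith) h1mem (by linarith))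
    linarith
  have hd0 : d ≤ 0 := by
    refine nonpos_of_forall_mul_le (K := r * d - (M₀ + 1) * d - (u₀ - 1) * a) fun k hk => ?_
    have := hsep (u₀ - 1) 1 (M₀ + 1 + k) (hbox _ _ _ (by linarith) h1mem (by linarith))
    linarith
  have hapos : 0 < a := by
    refine lt_of_le_of_ne (by linarith) fun h0 => hf0 ?_
    have hd' : d = 0 := by
      have := hsep (∫ ω, H 0 ω ∂P) 1 0 ⟨0, fun _ => 1, measurable_const, fun _ => zero_le_one,
        ⟨1, fun _ => le_rfl⟩, by simp, by simp, le_rfl, by simp [hφ.map_one]⟩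
      rw [← h0] at this
      nlinarith
    have hb' : b = 0 := by
      have g1 := hsep (u₀ - 1) (1 - δ / 2) (M₀ + 1)
        (hbox _ _ _ (by linarith) ⟨by linarith, by linarith⟩ (by linarith))
      have g2 := hsep (u₀ - 1) (1 + δ / 2) (M₀ + 1)
        (hbox _ _ _ (by linarith) ⟨by linarith, by linarith⟩ (by linarith))
      rw [← h0, hd'] at g1 g2
      nlinarith
    refine ContinuousLinearMap.ext fun p => ?_
    rw [show p = (p.1, p.2.1, p.2.2) from rfl, hfeq, ← h0, hd', hb']
    simp
  refine ⟨b / a, -d / a, div_nonneg (by linarith) hapos.le, ?_⟩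
  intro n q hqm hq0 hM hfin
  have := hsep (∫ ω, q ω * H n ω ∂P) (∫ ω, q ω ∂P) (∫⁻ ω, φ (q ω) ∂P).toReal
    ⟨n, q, hqm, hq0, hM, le_rfl, rfl, ENNReal.toReal_nonneg, by
      rw [ENNReal.ofReal_toReal hfin]⟩
  have e : ∫ ω, q ω * H n ω ∂P + b / a * ∫ ω, q ω ∂P - -d / a * (∫⁻ ω, φ (q ω) ∂P).toReal =
      ((∫ ω, q ω * H n ω ∂P) * a + (∫ ω, q ω ∂P) * b + (∫⁻ ω, φ (q ω) ∂P).toReal * d) / a := by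
    field_simp
    ring
  have e' : b / a - -d / a * r = (b + r * d) / a := by field_simp; ring
  rw [e, e']
  exact div_le_div_of_nonneg_right this hapos.le

/-! ### Strong duality -/

theorem measurable_partialSups {α : Type*} [MeasurableSpace α] {g : ℕ → α → ℝ}
    (hg : ∀ i, Measurable (g i)) (n : ℕ) : Measurable fun a => partialSups (fun i => g i a) n := by
  induction n with
  | zero => simpa using hg 0
  | succ n ih =>
    simp only [← Order.succ_eq_add_one, partialSups_succ]
    exact ih.sup (hg _)

theorem le_sum_abs_of_le (s : ℕ → ℝ) {n k : ℕ} (hk : k ≤ n) :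
    s k ≤ ∑ i ∈ Finset.range (n + 1), |s i| :=
  (le_abs_self _).trans (Finset.single_le_sum (f := fun i => |s i|) (fun _ _ => abs_nonneg _)
    (Finset.mem_range.2 (Nat.lt_succ_of_le hk)))

/-- The dual bound, with the closed perspective of `φ₂*` in place of the convention at `η = 0`.
Measurable maximizers over finitely many points of the domains of `φ₁` and `φ₂` turn the integrals
of suprema into suprema of integrals; monotone convergence removes the finiteness. -/
theorem exists_dual_bound {Ω : Type*} [MeasurableSpace Ω]
    {P₀ : Measure Ω} [IsProbabilityMeasure P₀] {X : Ω → ℝ} (hX : Integrable X P₀)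
    (hXm : Measurable X)
    {φ₁ φ₂ : ℝ → ℝ≥0∞} (hφ₁ : IsDivergenceFunction φ₁) (hφ₂ : IsDivergenceFunction φ₂)
    (hm₁ : Measurable φ₁) (hm₂ : Measurable φ₂) {r θ₂ : ℝ} (hr : 0 < r)
    (hρ : robustShortfall φ₁ φ₂ P₀ r X ≤ (θ₂ : EReal)) :
    ∃ (θ₁ η : ℝ) (F : Ω → ℝ), 0 ≤ η ∧ Integrable F P₀ ∧ ∫ ω, F ω ∂P₀ ≤ θ₁ - η * r ∧
      ∀ᵐ ω ∂P₀, ∃ h : ℝ, conj φ₁ ((-θ₂ - X ω : ℝ) : EReal) = h ∧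
        ∀ t, φ₂ t < ⊤ → t * (h + θ₁) - η * (φ₂ t).toReal ≤ F ω := by
  obtain ⟨t, ht0, htφ, hts⟩ := hφ₁.exists_seq
  obtain ⟨u, hu0, huφ, hus⟩ := hφ₂.exists_seq
  have ht_nn : ∀ i, 0 ≤ t i := fun i => hφ₁.nonneg_of_lt_top (htφ i)
  have hu_nn : ∀ i, 0 ≤ u i := fun i => hφ₂.nonneg_of_lt_top (huφ i)
  set g : ℕ → Ω → ℝ := fun i ω => t i * (-θ₂ - X ω) - (φ₁ (t i)).toReal with hg
  have hYi : Integrable (fun ω => -θ₂ - X ω) P₀ := (integrable_const _).sub hX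
  have hgm : ∀ i, Measurable (g i) := fun i =>
    ((measurable_const.sub hXm).const_mul _).sub measurable_const
  have hgi : ∀ i, Integrable (g i) P₀ := fun i => (hYi.const_mul _).sub (integrable_const _)
  set H : ℕ → Ω → ℝ := fun n ω => partialSups (fun i => g i ω) n with hH
  have hHi : ∀ n, Integrable (H n) P₀ := integrable_partialSups hgi
  have hHm : ∀ n, Measurable (H n) := measurable_partialSups hgm
  have hHmono : ∀ ω, Monotone fun n => H n ω := fun ω => (partialSups fun i => g i ω).monotone
  obtain ⟨θ₁, η, hη, hmult⟩ := exists_multipliers hφ₂ hm₂ hr hHi hHmono (by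
    rintro n q hqm hq0 ⟨M, hM⟩ hq1 hqr
    obtain ⟨N, hNm, hNn, hN⟩ := exists_measurable_argmax hgm n
    have htN : Measurable fun k => t k := measurable_of_countable _
    have := integral_mul_le_zero_of_robustShortfall_le hX hm₁ hρ hqm hq0 hM hq1 hqr
      (z := fun ω => t (N ω)) (htN.comp hNm) (fun ω => ht_nn _)
      (fun ω => le_sum_abs_of_le t (hNn ω)) (fun ω => htφ _)
      (fun ω => le_sum_abs_of_le (fun k => (φ₁ (t k)).toReal) (hNn ω))
    simpa only [hH, hN] using this)
  set f : ℕ → Ω → ℝ := fun n ω =>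
    partialSups (fun j => u j * (H n ω + θ₁) - η * (φ₂ (u j)).toReal) n with hf
  have hki : ∀ n j, Integrable (fun ω => u j * (H n ω + θ₁) - η * (φ₂ (u j)).toReal) P₀ :=
    fun n j => (((hHi n).add (integrable_const _)).const_mul _).sub (integrable_const _)
  have hkm : ∀ n j, Measurable (fun ω => u j * (H n ω + θ₁) - η * (φ₂ (u j)).toReal) :=
    fun n j => (((hHm n).add measurable_const).const_mul _).sub measurable_const
  have hfi : ∀ n, Integrable (f n) P₀ := fun n => integrable_partialSups (hki n) n
  have hfmono : ∀ ω, Monotone fun n => f n ω := by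
    intro ω n n' hn
    refine ((partialSups _).monotone hn).trans (partialSups_mono (fun j => ?_) n')
    have := mul_le_mul_of_nonneg_left (hHmono ω hn) (hu_nn j)
    dsimp only at this ⊢
    linarith
  have hfle : ∀ n, ∫ ω, f n ω ∂P₀ ≤ θ₁ - η * r := by
    intro n
    obtain ⟨N, hNm, hNn, hN⟩ := exists_measurable_argmax (hkm n) n
    set q : Ω → ℝ := fun ω => u (N ω) with hq
    have hqm : Measurable q := (measurable_of_countable fun k => u k).comp hNm
    have hq0 : ∀ ω, 0 ≤ q ω := fun ω => hu_nn _
    have hqM : ∀ ω, q ω ≤ ∑ i ∈ Finset.range (n + 1), |u i| := fun ω =>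
      le_sum_abs_of_le u (hNn ω)
    have hφq : Measurable fun ω => φ₂ (q ω) := hm₂.comp hqm
    have hfin : ∫⁻ ω, φ₂ (q ω) ∂P₀ ≠ ⊤ := by
      have hb : ∀ ω, φ₂ (q ω) ≤ ∑ i ∈ Finset.range (n + 1), φ₂ (u i) := fun ω =>
        Finset.single_le_sum (f := fun i => φ₂ (u i)) (fun _ _ => zero_le)
          (Finset.mem_range.2 (Nat.lt_succ_of_le (hNn ω)))
      refine ne_top_of_le_ne_top ?_ (lintegral_mono hb)
      simp only [lintegral_const, measure_univ, mul_one]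
      exact (ENNReal.sum_lt_top.2 fun i _ => huφ i).ne
    have h1 := hmult n q hqm hq0 ⟨_, hqM⟩ hfin
    have hqi : Integrable q P₀ := by
      simpa using integrable_mul_of_bounded hqm hq0 hqM (integrable_const (1 : ℝ))
    have hqH := integrable_mul_of_bounded hqm hq0 hqM (hHi n)
    have hφi : Integrable (fun ω => (φ₂ (q ω)).toReal) P₀ :=
      integrable_toReal_of_lintegral_ne_top hφq.aemeasurable hfin
    have hs : Integrable (fun ω => q ω * H n ω + θ₁ * q ω) P₀ := hqH.add (hqi.const_mul _)
    have e : ∫ ω, f n ω ∂P₀ = ∫ ω, q ω * H n ω ∂P₀ + θ₁ * ∫ ω, q ω ∂P₀ -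
        η * (∫⁻ ω, φ₂ (q ω) ∂P₀).toReal := by
      rw [← integral_toReal hφq.aemeasurable (ae_lt_top hφq hfin), ← integral_const_mul,
        ← integral_const_mul, ← integral_add hqH (hqi.const_mul _),
        ← integral_sub hs (hφi.const_mul _)]
      congr 1; ext ω
      simp only [hf, hN, hq]; ring
    rw [e]; exact h1
  obtain ⟨F, hFi, hFle, hF⟩ := exists_integrable_ge_of_monotone hfi hfmono hfle
  refine ⟨θ₁, η, F, hη, hFi, hFle, ?_⟩
  filter_upwards [hF] with ω hω
  have hall : ∀ n j, u j * (H n ω + θ₁) - η * (φ₂ (u j)).toReal ≤ F ω := by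
    intro n j
    have h1 := le_partialSups_of_le (fun k => u k * (H (max n j) ω + θ₁) -
      η * (φ₂ (u k)).toReal) (le_max_right n j)
    have h2 := mul_le_mul_of_nonneg_left (hHmono ω (le_max_left n j)) (hu_nn j)
    have h3 := hω (max n j)
    dsimp only [hf] at h1 h2 h3
    linarith
  have hHF : ∀ n, H n ω ≤ F ω - θ₁ := fun n => by
    have := hall n 0
    rw [hu0, hφ₂.map_one] at this
    simp at this; linarith
  have hsup : ∀ b : ℝ, (∀ n, H n ω ≤ b) → conj φ₁ ((-θ₂ - X ω : ℝ) : EReal) ≤ (b : EReal) := by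
    intro b hb
    rw [conj_le_iff]
    intro s hs
    have := hts (-θ₂ - X ω) 1 b zero_le_one (fun n => by
      rw [one_mul]
      exact (le_partialSups (fun i => g i ω) n).trans (hb n)) s hs
    rwa [one_mul] at this
  obtain ⟨h, hh⟩ := exists_conj_eq_of_le hφ₁ _ rfl (hsup _ hHF)
  refine ⟨h, hh, fun s hs => ?_⟩
  refine hus _ η _ hη (fun j => ?_) s hs
  rcases (hu_nn j).eq_or_lt with h0 | hpos
  · have := hall 0 j
    rw [← h0] at this ⊢
    simpa using this
  · have h1 : ∀ n, H n ω ≤ (F ω + η * (φ₂ (u j)).toReal) / u j - θ₁ := fun n => by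
      have := hall n j
      rw [le_sub_iff_add_le, le_div_iff₀ hpos]
      linarith
    have h2 := hsup _ h1
    rw [hh, EReal.coe_le_coe_iff, le_sub_iff_add_le, le_div_iff₀ hpos] at h2
    linarith

/-- The support function of the domain of `φ`, written as `B s⁺ - a s⁻` with `a` the infimum of
the domain and `B` its supremum; if the domain is unbounded, `B = 1`, which is harmless because
the support function is then infinite at every `s > 0`. -/
theorem IsDivergenceFunction.exists_slopes {φ : ℝ → ℝ≥0∞} (hφ : IsDivergenceFunction φ) :
    ∃ a B : ℝ, 0 ≤ a ∧ a ≤ 1 ∧ 1 ≤ B ∧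
      (∀ s y : ℝ, (∀ t, φ t < ⊤ → t * s ≤ y) → B * max s 0 + a * min s 0 ≤ y) ∧
      ∀ s y s' : ℝ, (∀ t, φ t < ⊤ → t * s ≤ y) → s' ≤ s →
        ∀ t, φ t < ⊤ → t * s' ≤ B * max s' 0 + a * min s' 0 := by
  classical
  set D : Set ℝ := {t | φ t < ⊤} with hD
  have h1D : (1 : ℝ) ∈ D := hφ.one_lt_top
  have hbelow : BddBelow D := ⟨0, fun t ht => hφ.nonneg_of_lt_top ht⟩
  have hbdd : ∀ s y : ℝ, (∀ t, φ t < ⊤ → t * s ≤ y) → 0 < s → BddAbove D := fun s y h hs =>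
    ⟨y / s, fun t ht => (le_div_iff₀ hs).2 (h t ht)⟩
  refine ⟨sInf D, if BddAbove D then sSup D else 1,
    le_csInf ⟨1, h1D⟩ fun t ht => hφ.nonneg_of_lt_top ht, csInf_le hbelow h1D, ?_, ?_, ?_⟩
  · split_ifs with h
    · exact le_csSup h h1D
    · exact le_rfl
  · intro s y h
    rcases lt_trichotomy s 0 with hs | rfl | hs
    · rw [max_eq_right hs.le, min_eq_left hs.le, mul_zero, zero_add]
      have : y / s ≤ sInf D := le_csInf ⟨1, h1D⟩ fun t ht => (div_le_iff_of_neg hs).2 (h t ht)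
      exact (div_le_iff_of_neg hs).1 this
    · simpa using h 1 h1D
    · rw [max_eq_left hs.le, min_eq_right hs.le, mul_zero, add_zero, if_pos (hbdd s y h hs)]
      have : sSup D ≤ y / s := csSup_le ⟨1, h1D⟩ fun t ht => (le_div_iff₀ hs).2 (h t ht)
      exact (le_div_iff₀ hs).1 this
  · intro s y s' h hs' t ht
    rcases le_or_gt s' 0 with h0 | h0
    · rw [max_eq_right h0, min_eq_left h0, mul_zero, zero_add]
      exact mul_le_mul_of_nonpos_right (csInf_le hbelow ht) h0
    · have hb := hbdd s y h (h0.trans_le hs')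
      rw [max_eq_left h0.le, min_eq_right h0.le, mul_zero, add_zero, if_pos hb]
      exact mul_le_mul_of_nonneg_right (le_csSup hb ht) h0.le

/-- Dual feasibility slightly above any upper bound `θ₂` of the risk measure. When the multiplier
`η` vanishes, the convention at `η = 0` may be stricter than the support function of the domain of
`φ₂`. Then either moving from `θ₂` to `θ₂ + ε` strictly lowers the dual integral, which makes room
for a positive `η`, or it does not, and then the integrand vanishes for a suitable `θ₁`. -/
theorem exists_feasible {Ω : Type*} [MeasurableSpace Ω]
    {P₀ : Measure Ω} [IsProbabilityMeasure P₀] {X : Ω → ℝ} (hX : Integrable X P₀)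
    (hXm : Measurable X)
    {φ₁ φ₂ : ℝ → ℝ≥0∞} (hφ₁ : IsDivergenceFunction φ₁) (hφ₂ : IsDivergenceFunction φ₂)
    (hm₁ : Measurable φ₁) (hm₂ : Measurable φ₂) {r θ₂ : ℝ} (hr : 0 < r)
    (hρ : robustShortfall φ₁ φ₂ P₀ r X ≤ (θ₂ : EReal)) {ε : ℝ} (hε : 0 < ε) :
    ∃ θ₁' θ₂' η' : ℝ, 0 ≤ η' ∧ θ₂' ≤ θ₂ + ε ∧
      extIntegral P₀ (fun ω => dualIntegrand φ₁ φ₂ (X ω) θ₁' θ₂' η') ≤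
        ((θ₁' - η' * r : ℝ) : EReal) := by
  obtain ⟨θ₁, η, F, hη, hFi, hFle, hF⟩ := exists_dual_bound hX hXm hφ₁ hφ₂ hm₁ hm₂ hr hρ
  rcases hη.eq_or_lt with h0 | hpos
  swap
  · refine ⟨θ₁, θ₂, η, hη, by linarith, ?_⟩
    refine (extIntegral_mono_ae (g := fun ω => (F ω : EReal)) ?_).trans ?_
    · filter_upwards [hF] with ω ⟨h, hh, hω⟩
      exact dualIntegrand_le hpos hh hω
    · rw [extIntegral_coe hFi]; exact_mod_cast hFle
  subst h0
  rw [zero_mul, sub_zero] at hFle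
  obtain ⟨a, B, ha0, ha1, hB1, hsupp, hsupp'⟩ := hφ₂.exists_slopes
  set m : ℝ → ℝ := fun s => B * max s 0 + a * min s 0 with hmdef
  have hm_mono : Monotone m := fun s s' h => add_le_add
    (mul_le_mul_of_nonneg_left (max_le_max_right 0 h) (by linarith))
    (mul_le_mul_of_nonneg_left (min_le_min_right 0 h) ha0)
  have hm_ge : ∀ s, s ≤ m s := by
    intro s
    rcases le_total s 0 with h | h
    · simp only [hmdef, max_eq_right h, min_eq_left h]; nlinarith
    · simp only [hmdef, max_eq_left h, min_eq_right h]; nlinarith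
  set h : Ω → ℝ := fun ω => (conj φ₁ ((-θ₂ - X ω : ℝ) : EReal)).toReal with hh
  set k : Ω → ℝ := fun ω => (conj φ₁ ((-(θ₂ + ε) - X ω : ℝ) : EReal)).toReal with hk
  have hhm : Measurable h :=
    ((measurable_conj_coe hφ₁).comp (measurable_const.sub hXm)).ereal_toReal
  have hkm : Measurable k :=
    ((measurable_conj_coe hφ₁).comp (measurable_const.sub hXm)).ereal_toReal
  have hmm : Measurable m := hm_mono.measurable
  -- the facts that hold at almost every point
  have hgood : ∀ᵐ ω ∂P₀, conj φ₁ ((-θ₂ - X ω : ℝ) : EReal) = h ω ∧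
      conj φ₁ ((-(θ₂ + ε) - X ω : ℝ) : EReal) = k ω ∧ k ω ≤ h ω ∧ -(θ₂ + ε) - X ω ≤ k ω ∧
      m (h ω + θ₁) ≤ F ω ∧ ∀ t, φ₂ t < ⊤ → t * (k ω + θ₁) ≤ m (k ω + θ₁) := by
    filter_upwards [hF] with ω ⟨b, hb, hω⟩
    have hbh : h ω = b := by rw [hh]; dsimp only; rw [hb, EReal.toReal_coe]
    have hle : conj φ₁ ((-(θ₂ + ε) - X ω : ℝ) : EReal) ≤ (b : EReal) :=
      hb ▸ hφ₁.conj_mono (by exact_mod_cast (by linarith : -(θ₂ + ε) - X ω ≤ -θ₂ - X ω))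
    obtain ⟨b', hb'⟩ := exists_conj_eq_of_le hφ₁ b rfl hle
    have hbk : k ω = b' := by rw [hk]; dsimp only; rw [hb', EReal.toReal_coe]
    have hb'b : b' ≤ b := by rw [hb'] at hle; exact_mod_cast hle
    have hge : -(θ₂ + ε) - X ω ≤ b' := by
      have := hφ₁.le_conj ((-(θ₂ + ε) - X ω : ℝ) : EReal)
      rw [hb'] at this; exact_mod_cast this
    have hω' : ∀ t, φ₂ t < ⊤ → t * (b + θ₁) ≤ F ω := fun t ht => by simpa using hω t ht
    rw [hbh, hbk]
    exact ⟨hb, hb', hb'b, hge, hsupp _ _ hω', hsupp' _ _ _ hω' (by linarith)⟩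
  have hlow : Integrable (fun ω => -(θ₂ + ε) - X ω + θ₁) P₀ :=
    ((integrable_const _).sub hX).add (integrable_const _)
  have hmk : Integrable (fun ω => m (k ω + θ₁)) P₀ := by
    refine integrable_of_le_of_le (hmm.comp (hkm.add_const θ₁)).aestronglyMeasurable
      ?_ ?_ hlow hFi
    · filter_upwards [hgood] with ω ⟨_, _, _, h4, _, _⟩
      exact le_trans (by linarith) (hm_ge _)
    · filter_upwards [hgood] with ω ⟨_, _, h3, _, h5, _⟩
      exact (hm_mono (by linarith)).trans h5
  have hmh : Integrable (fun ω => m (h ω + θ₁)) P₀ := by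
    refine integrable_of_le_of_le (hmm.comp (hhm.add_const θ₁)).aestronglyMeasurable
      ?_ ?_ hlow hFi
    · filter_upwards [hgood] with ω ⟨_, _, h3, h4, _, _⟩
      exact le_trans (by linarith) (hm_ge _)
    · filter_upwards [hgood] with ω ⟨_, _, _, _, h5, _⟩
      exact h5
  have hmhle : ∫ ω, m (h ω + θ₁) ∂P₀ ≤ θ₁ :=
    (integral_mono_ae hmh hFi (hgood.mono fun ω hω => hω.2.2.2.2.1)).trans hFle
  have hkh : (fun ω => m (k ω + θ₁)) ≤ᵐ[P₀] fun ω => m (h ω + θ₁) :=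
    hgood.mono fun ω hω => hm_mono (by linarith [hω.2.2.1])
  rcases (integral_mono_ae hmk hmh hkh).lt_or_eq with hlt | heq
  · -- the gain in the dual integral pays for a positive multiplier of the divergence constraint
    set κ := ∫ ω, m (h ω + θ₁) ∂P₀ - ∫ ω, m (k ω + θ₁) ∂P₀ with hκ
    have hκ0 : 0 < κ / r := div_pos (sub_pos.2 hlt) hr
    refine ⟨θ₁, θ₂ + ε, κ / r, hκ0.le, le_rfl, ?_⟩
    refine (extIntegral_mono_ae (g := fun ω => ((m (k ω + θ₁) : ℝ) : EReal)) ?_).trans ?_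
    · filter_upwards [hgood] with ω ⟨_, h2, _, _, _, h6⟩
      refine dualIntegrand_le hκ0 h2 fun t ht => ?_
      have := mul_nonneg hκ0.le (ENNReal.toReal_nonneg (a := φ₂ t))
      linarith [h6 t ht]
    · rw [extIntegral_coe hmk, div_mul_cancel₀ _ hr.ne']
      exact_mod_cast (by rw [hκ]; linarith : ∫ ω, m (k ω + θ₁) ∂P₀ ≤ θ₁ - κ)
  have hmeq := (integral_eq_iff_of_ae_le hmk hmh hkh).1 heq
  -- where the conjugate strictly decreases, `m` has to be constant on an interval
  have hstrict : ∀ s' s : ℝ, s' < s → m s' = m s → s ≤ 0 ∧ a = 0 := by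
    intro s' s hs hms
    have hs0 : s ≤ 0 := by
      by_contra! hpos
      simp only [hmdef, max_eq_left hpos.le, min_eq_right hpos.le] at hms
      rcases le_total s' 0 with h1 | h1
      · simp only [max_eq_right h1, min_eq_left h1] at hms
        nlinarith
      · simp only [max_eq_left h1, min_eq_right h1] at hms
        nlinarith
    refine ⟨hs0, ?_⟩
    simp only [hmdef, max_eq_right hs0, min_eq_left hs0, max_eq_right (hs.le.trans hs0),
      min_eq_left (hs.le.trans hs0)] at hms
    by_contra hne
    exact hs.ne (mul_left_cancel₀ hne (by linarith))
  have hall := hgood.and hmeq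
  by_cases hex : ∀ᵐ ω ∂P₀, k ω = h ω
  · -- the conjugate is almost surely at its minimum
    obtain ⟨ω₁, ⟨h1, h2, -⟩, hω₁⟩ := (hgood.and hex).exists
    have hmin : ∀ᵐ ω ∂P₀, h ω = h ω₁ := by
      filter_upwards [hgood, hex] with ω ⟨g1, g2, _⟩ hω
      have e1 : (h ω : EReal) ≤ h ω₁ := by
        rw [← h1]
        exact hφ₁.conj_le_of_eq (by linarith : -(θ₂ + ε) - X ω < -θ₂ - X ω) g1 (hω ▸ g2) _
      have e2 : (h ω₁ : EReal) ≤ h ω := by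
        rw [← g1]
        exact hφ₁.conj_le_of_eq (by linarith : -(θ₂ + ε) - X ω₁ < -θ₂ - X ω₁) h1 (hω₁ ▸ h2) _
      exact le_antisymm (by exact_mod_cast e1) (by exact_mod_cast e2)
    have hneg : 0 ≤ -h ω₁ := by
      have : ∫ ω, m (h ω + θ₁) ∂P₀ = m (h ω₁ + θ₁) := by
        rw [integral_congr_ae (g := fun _ => m (h ω₁ + θ₁))
          (hmin.mono fun ω hω => by dsimp only; rw [hω])]
        simp
      have := hm_ge (h ω₁ + θ₁)
      linarith
    refine ⟨-h ω₁, θ₂, 0, le_rfl, by linarith, ?_⟩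
    rw [extIntegral_eq_zero_of_ae]
    · exact_mod_cast (by simpa using hneg : 0 ≤ -h ω₁ - 0 * r)
    · filter_upwards [hgood, hmin] with ω ⟨g1, _⟩ hω
      exact dualIntegrand_zero g1 (by linarith)
  · -- here the domain of `φ₂` reaches down to `0` and the argument of its conjugate is nonpositive
    obtain ⟨ω₀, hne, ⟨h1, h2, h3, -⟩, hm0⟩ :=
      ((Filter.not_eventually.1 hex).and_eventually hall).exists
    have hlt : k ω₀ < h ω₀ := lt_of_le_of_ne h3 hne
    obtain ⟨hs0, ha⟩ := hstrict _ _ (by linarith : k ω₀ + θ₁ < h ω₀ + θ₁) hm0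
    have hsn : ∀ᵐ ω ∂P₀, h ω + θ₁ ≤ 0 := by
      filter_upwards [hall] with ω ⟨⟨g1, g2, g3, _⟩, gm⟩
      rcases g3.lt_or_eq with g | g
      · exact (hstrict _ _ (by linarith : k ω + θ₁ < h ω + θ₁) gm).1
      · have e1 : (h ω : EReal) ≤ h ω₀ := by
          rw [← h1]
          exact hφ₁.conj_le_of_eq (by linarith : -(θ₂ + ε) - X ω < -θ₂ - X ω) g1 (g ▸ g2) _
        have : h ω ≤ h ω₀ := by exact_mod_cast e1
        linarith
    have hθ : 0 ≤ θ₁ := by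
      refine le_trans (integral_nonneg_of_ae ?_) hmhle
      filter_upwards [hsn] with ω hω
      simp [hmdef, ha, hω]
    refine ⟨θ₁, θ₂, 0, le_rfl, by linarith, ?_⟩
    rw [extIntegral_eq_zero_of_ae]
    · exact_mod_cast (by simpa using hθ : 0 ≤ θ₁ - 0 * r)
    · filter_upwards [hgood, hsn] with ω ⟨g1, _⟩ hω
      exact dualIntegrand_zero g1 hω

/-! ### Finiteness, change of variables and the duality theorem -/

theorem robustShortfall_congr_ae {Ω : Type*} [MeasurableSpace Ω] {P₀ : Measure Ω}
    {φ₁ φ₂ : ℝ → ℝ≥0∞} {r : ℝ} {X X' : Ω → ℝ} (h : X =ᵐ[P₀] X') :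
    robustShortfall φ₁ φ₂ P₀ r X = robustShortfall φ₁ φ₂ P₀ r X' := by
  unfold robustShortfall
  refine iSup_congr fun c => iSup_congr fun _ => iSup_congr fun Q => iSup_congr fun _ =>
    iSup_congr fun hI => iSup_congr fun Q' => iSup_congr fun _ => iSup_congr fun hac => ?_
  congr 1
  refine extIntegral_congr_ae ?_
  filter_upwards [(hac.trans (absolutelyContinuous_of_phiDivergence_le hI)).ae_le h] with ω hω
  rw [hω]

/-- The risk measure is at least the expected loss `E[-X]`: take `Q = Q' = P₀`. -/
theorem robustShortfall_ne_bot {Ω : Type*} [MeasurableSpace Ω]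
    {P₀ : Measure Ω} [IsProbabilityMeasure P₀] {X : Ω → ℝ} (hX : Integrable X P₀)
    {φ₁ φ₂ : ℝ → ℝ≥0∞} (hφ₁ : IsDivergenceFunction φ₁) (hφ₂ : IsDivergenceFunction φ₂) (r : ℝ) :
    robustShortfall φ₁ φ₂ P₀ r X ≠ ⊥ := by
  have hone : ∀ φ : ℝ → ℝ≥0∞, φ 1 = 0 → phiDivergence φ P₀ P₀ = 0 := by
    intro φ hφ
    rw [phiDivergence, if_pos Measure.AbsolutelyContinuous.rfl]
    rw [lintegral_congr_ae (g := fun _ => 0), lintegral_zero]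
    filter_upwards [Measure.rnDeriv_self P₀] with ω hω
    rw [hω]; simpa using hφ
  intro h
  have hle : robustShortfall φ₁ φ₂ P₀ r X ≤ ⊥ := h.le
  simp only [robustShortfall, iSup_le_iff] at hle
  have := hle 1 one_pos P₀ inferInstance (by rw [hone φ₂ hφ₂.map_one]; exact zero_le)
    P₀ inferInstance Measure.AbsolutelyContinuous.rfl
  rw [hone (scaledDivergence φ₁ 1) (by simp [scaledDivergence, hφ₁.map_one]),
    show extIntegral P₀ (fun ω => ((-X ω : ℝ) : EReal)) = ((∫ ω, -X ω ∂P₀ : ℝ) : EReal) from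
      extIntegral_coe hX.neg] at this
  simp at this

/-- Change of variables to a density of the law of `X`. -/
theorem extIntegral_comp_eq {Ω : Type*} [MeasurableSpace Ω] {P : Measure Ω} {X : Ω → ℝ}
    (hX : AEMeasurable X P) {ν : Measure ℝ} {f₀ : ℝ → ℝ} (hf : Measurable f₀)
    (hf0 : ∀ x, 0 ≤ f₀ x) (hlaw : P.map X = ν.withDensity fun x => ENNReal.ofReal (f₀ x))
    {β : ℝ → EReal} (hβ : Measurable β) :
    extIntegral ν (fun x => β x * ((f₀ x : ℝ) : EReal)) = extIntegral P (fun ω => β (X ω)) := by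
  have key : ∀ γ : ℝ → EReal, Measurable γ →
      ∫⁻ x, (γ x * ((f₀ x : ℝ) : EReal)).toENNReal ∂ν = ∫⁻ ω, (γ (X ω)).toENNReal ∂P := by
    intro γ hγ
    rw [← lintegral_map' (f := fun x => (γ x).toENNReal) hγ.ereal_toENNReal.aemeasurable hX, hlaw,
      lintegral_withDensity_eq_lintegral_mul _ hf.ennreal_ofReal hγ.ereal_toENNReal]
    refine lintegral_congr fun x => ?_
    have h0 : (0 : EReal) ≤ ((f₀ x : ℝ) : EReal) := by exact_mod_cast hf0 x
    rw [mul_comm, EReal.toENNReal_mul h0, EReal.toENNReal_of_ne_top (EReal.coe_ne_top _),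
      EReal.toReal_coe]
    rfl
  unfold extIntegral
  rw [key β hβ]
  congr 2
  rw [← key (fun x => -β x) hβ.neg]
  simp only [EReal.neg_mul]

theorem theorem2 {Ω : Type*} [MeasurableSpace Ω]
    (P₀ : Measure Ω) [IsProbabilityMeasure P₀]
    (X : Ω → ℝ) (hX : Integrable X P₀)
    (φ₁ φ₂ : ℝ → ℝ≥0∞)
    (hφ₁ : IsDivergenceFunction φ₁) (hφ₂ : IsDivergenceFunction φ₂)
    (hlsc₁ : LowerSemicontinuous φ₁) (hlsc₂ : LowerSemicontinuous φ₂)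
    (r : ℝ) (hr : 0 < r) :
    -- finiteness criterion, for any density `f₀` of `X` with respect to any σ-finite `dx`
    (∀ (dx : Measure ℝ) [SigmaFinite dx] (f₀ : ℝ → ℝ), Measurable f₀ → (∀ x, 0 ≤ f₀ x) →
      P₀.map X = dx.withDensity (fun x => ENNReal.ofReal (f₀ x)) →
      ((robustShortfall φ₁ φ₂ P₀ r X ≠ ⊥ ∧ robustShortfall φ₁ φ₂ P₀ r X ≠ ⊤) ↔
        ∃ θ₁ θ₂ η : ℝ, 0 ≤ η ∧
          extIntegral dx (fun x => dualIntegrand φ₁ φ₂ x θ₁ θ₂ η * ((f₀ x : ℝ) : EReal)) ≤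
            ((θ₁ - η * r : ℝ) : EReal))) ∧
    -- duality; the infimum over the empty set is `+∞`
    robustShortfall φ₁ φ₂ P₀ r X =
      sInf {v : EReal | ∃ θ₁ θ₂ η : ℝ, 0 ≤ η ∧
        extIntegral P₀ (fun ω => dualIntegrand φ₁ φ₂ (X ω) θ₁ θ₂ η) ≤
          ((θ₁ - η * r : ℝ) : EReal) ∧
        v = ((θ₂ : ℝ) : EReal)} := by

  have hm₁ : Measurable φ₁ := hlsc₁.measurable
  have hm₂ : Measurable φ₂ := hlsc₂.measurable
  set X' : Ω → ℝ := hX.aestronglyMeasurable.mk X with hX'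
  have hXX' : X =ᵐ[P₀] X' := hX.aestronglyMeasurable.ae_eq_mk
  have hX'm : Measurable X' := hX.aestronglyMeasurable.stronglyMeasurable_mk.measurable
  have hdual : robustShortfall φ₁ φ₂ P₀ r X =
      sInf {v : EReal | ∃ θ₁ θ₂ η : ℝ, 0 ≤ η ∧
        extIntegral P₀ (fun ω => dualIntegrand φ₁ φ₂ (X ω) θ₁ θ₂ η) ≤
          ((θ₁ - η * r : ℝ) : EReal) ∧
        v = ((θ₂ : ℝ) : EReal)} := by
    refine le_antisymm (le_sInf ?_) ?_
    · rintro v ⟨θ₁, θ₂, η, hη, hfeas, rfl⟩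
      exact robustShortfall_le hX hφ₁ hφ₂ hm₁ hm₂ hr.le hη hfeas
    · refine EReal.le_of_forall_lt_iff_le.1 fun y hy => ?_
      obtain ⟨x, hx, hxy⟩ := EReal.lt_iff_exists_real_btwn.1 hy
      have hxy' : x < y := by exact_mod_cast hxy
      have hle : robustShortfall φ₁ φ₂ P₀ r X' ≤ (x : EReal) :=
        robustShortfall_congr_ae hXX' ▸ hx.le
      obtain ⟨θ₁, θ₂, η, hη, hθ₂, hfeas⟩ := exists_feasible (hX.congr hXX') hX'm hφ₁ hφ₂ hm₁ hm₂
        hr hle (sub_pos.2 hxy')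
      refine le_trans (b := (θ₂ : EReal)) (sInf_le ⟨θ₁, θ₂, η, hη, ?_, rfl⟩)
        (by exact_mod_cast (by linarith : θ₂ ≤ y))
      rwa [extIntegral_congr_ae (g := fun ω => dualIntegrand φ₁ φ₂ (X' ω) θ₁ θ₂ η)]
      filter_upwards [hXX'] with ω hω
      rw [hω]
  refine ⟨?_, hdual⟩
  intro dx _ f₀ hf hf0 hlaw
  have hcomp : ∀ θ₁ θ₂ η : ℝ, 0 ≤ η →
      extIntegral dx (fun x => dualIntegrand φ₁ φ₂ x θ₁ θ₂ η * ((f₀ x : ℝ) : EReal)) =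
        extIntegral P₀ (fun ω => dualIntegrand φ₁ φ₂ (X ω) θ₁ θ₂ η) := fun θ₁ θ₂ η hη =>
    extIntegral_comp_eq hX.aemeasurable hf hf0 hlaw (measurable_dualIntegrand hφ₁ hφ₂ θ₁ θ₂ hη)
  constructor
  · rintro ⟨-, htop⟩
    rw [hdual, ← lt_top_iff_ne_top, sInf_lt_iff] at htop
    obtain ⟨v, ⟨θ₁, θ₂, η, hη, hfeas, -⟩, -⟩ := htop
    exact ⟨θ₁, θ₂, η, hη, (hcomp θ₁ θ₂ η hη).trans_le hfeas⟩
  · rintro ⟨θ₁, θ₂, η, hη, hfeas⟩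
    rw [hcomp θ₁ θ₂ η hη] at hfeas
    exact ⟨robustShortfall_ne_bot hX hφ₁ hφ₂ r, ((robustShortfall_le hX hφ₁ hφ₂ hm₁ hm₂ hr.le hη
      hfeas).trans_lt (EReal.coe_lt_top θ₂)).ne⟩
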